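/- **Theorem 1.4.** Let $G$ be a finite bipartite multigraph (parallel edges allowed) with parts $X$ and $Y$. Let $\delta_X(G)$ and $\delta_Y(G)$ be the minimum degrees over the vertices of $X$ and of $Y$, counted with multiplicity, and let $\Phi(G)$ be the number of maximum matchings of $G$, that is, of sets of pairwise disjoint edges with the largest possible number of edges (parallel edges count as different edges). Let $k\ge 0$ be an integer and suppose that $|X|\ge 2$, $\delta_X(G)\ge k$, $t=|Y|-|X|\ge 0$, and that Hall's Condition holds for $X$: $|N(S)|\ge|S|$ for every $S\subseteq X$. Then 1. $\Phi(G)\ge k(t+1)$ if $\delta_Y(G)\ge 1$, unless $|X|=2$, $t\ge1$, $\delta_Y(G)=1$ and $k\ge2$; 2. $\Phi(G)\ge (2k-t-2)(t+1)$ if $\delta_Y(G)\ge 2$ and $|X|=2$; 3. $\Phi(G)\ge 2k(t+1)-1$ if $\delta_Y(G)\ge 2$, $|X|\ge 3$ and $k=3$; 4. $\Phi(G)\ge 2k(t+1)$ if $\delta_Y(G)\ge 2$, $|X|\ge 3$ and $k\ge 4$. The following graphs, all satisfying Hall's Condition for $X$, attain these bounds. * For $n\ge3$, $k\ge1$, $t\ge0$,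 let $H_{n-1,k}$ have parts $\{x_1,\dots,x_{n-1}\}$ and $\{y_1,\dots,y_{n-1}\}$ and, for each $i$, one edge $x_iy_i$ and $k-1$ further edges $x_iy_1$. Add one vertex $x^*$ to $X$ and $t+1$ vertices to $Y$, join $x^*$ to every vertex of $Y$ by one edge, and, if the degree of $x^*$ is less than $k$, raise it to $k$ by further edges $x^*y_1$. The result $G_{n,k,t}$ has $|X|=n$, $|Y|=n+t$, $\delta_X=k$, $\delta_Y=1$ and $\Phi=k(t+1)$. If $x^*$ is instead joined to every vertex of $Y$ by two edges, the result $G'_{n,k,t}$ has $|X|=n$, $|Y|=n+t$, $\delta_X=k$, $\delta_Y=2$ and $\Phi=2k(t+1)$. * For $0\le t<k-1$, let $L_{k,t}$ be obtained from $K_{2,t+1}$ (with $X$ the part of size $2$) by adding to $Y$ one vertex joined by $k-t-1$ edges to each vertex of $X$. It has $|X|=2$, $|Y|=t+2$, $\delta_X=k$, $\delta_Y=2$ and $\Phi=(2k-t-2)(t+1)$. * Let $G_7$ be obtained from a $6$-cycle with parts of size $3$ by adding to $Y$ one vertex joined by one edge to each vertex of $X$. It has $|X|=3$, $|Y|=4$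 (so $t=1$), $\delta_X=3$, $\delta_Y=2$ and $\Phi=11=2\cdot3(t+1)-1$. -/

import Mathlib

/-- A bipartite multigraph with parts `X` and `Y`. The type `E` is the type of edges, and
`G.left e`, `G.right e` are the endpoints of the edge `e`; parallel edges are distinct
elements of `E` with the same endpoints. -/
structure Bigraph (X Y E : Type*) where
  left : E → X
  right : E → Y

namespace Bigraph

section Basic

variable {X Y E : Type*} (G : Bigraph X Y E)

/-- The degree of a vertex of `X`: the number of edges incident to it. -/
noncomputable def degX (x : X) : ℕ := {e : E | G.left e = x}.ncard

/-- The degree of a vertex of `Y`. -/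
noncomputable def degY (y : Y) : ℕ := {e : E | G.right e = y}.ncard

/-- The minimum degree of the vertices of `X` (for nonempty `X`). -/
noncomputable def minDegX : ℕ := ⨅ x : X, G.degX x

/-- The minimum degree of the vertices of `Y` (for nonempty `Y`). -/
noncomputable def minDegY : ℕ := ⨅ y : Y, G.degY y

/-- The union of the neighborhoods of the vertices in `S ⊆ X`. -/
def nbhd (S : Set X) : Set Y := {y | ∃ e : E, G.left e ∈ S ∧ G.right e = y}

/-- Hall's Condition for `X`. -/
def HallCondition : Prop := ∀ S : Set X, S.ncard ≤ (G.nbhd S).ncard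

/-- A matching is a set of pairwise disjoint edges. -/
def IsMatching (M : Finset E) : Prop :=
  ∀ e ∈ M, ∀ f ∈ M, e ≠ f → G.left e ≠ G.left f ∧ G.right e ≠ G.right f

/-- A maximum matching is a matching with the most edges. -/
def IsMaximumMatching (M : Finset E) : Prop :=
  G.IsMatching M ∧ ∀ M' : Finset E, G.IsMatching M' → M'.card ≤ M.card

/-- `Φ(G)`: the number of maximum matchings of `G`. -/
noncomputable def numMaxMatchings : ℕ := {M : Finset E | G.IsMaximumMatching M}.ncard

end Basic

section Constructions

variable {X Y : Type*}

/-- The edges of the multigraph in which `x` and `y` are joined by `m x y` parallel edges. -/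
abbrev MultEdge (m : X → Y → ℕ) : Type _ := (p : X × Y) × Fin (m p.1 p.2)

/-- The bipartite multigraph in which `x` and `y` are joined by `m x y` parallel edges. -/
def ofMult (m : X → Y → ℕ) : Bigraph X Y (MultEdge m) where
  left e := e.1.1
  right e := e.1.2

/-- Multiplicities of the graph with parts `x_1, …, x_p` and `y_1, …, y_p` that has one copy
of each `x_i y_i` and `k - 1` further copies of each `x_i y_1` (indices shifted to start
at `0`). -/
def multH (p k : ℕ) (i j : Fin p) : ℕ :=
  (if i = j then 1 else 0) + (if j.val = 0 then k - 1 else 0)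

/-- Multiplicities of the graph obtained from that of `multH (n - 1) k` by adding one vertex `x^*`
to `X` (the element of `Unit`) and `t + 1` vertices to `Y`, joining `x^*` to all `n + t` vertices
of `Y` with multiplicity `c`, and then adding just enough copies of `x^* y_1` to raise the degree
of `x^*` to `k` (none if it is at least `k` already). -/
def multG (c n k t : ℕ) : Fin (n - 1) ⊕ Unit → Fin (n - 1) ⊕ Fin (t + 1) → ℕ
  | .inl i, .inl j => multH (n - 1) k i j
  | .inl _, .inr _ => 0
  | .inr _, .inl j => c + (if j.val = 0 then k - c * (n + t) else 0)
  | .inr _, .inr _ => c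

/-- The graph `G_{n,k,t}`. -/
def graphG (n k t : ℕ) :
    Bigraph (Fin (n - 1) ⊕ Unit) (Fin (n - 1) ⊕ Fin (t + 1)) (MultEdge (multG 1 n k t)) :=
  ofMult (multG 1 n k t)

/-- The graph `G'_{n,k,t}`. -/
def graphG' (n k t : ℕ) :
    Bigraph (Fin (n - 1) ⊕ Unit) (Fin (n - 1) ⊕ Fin (t + 1)) (MultEdge (multG 2 n k t)) :=
  ofMult (multG 2 n k t)

/-- Multiplicities of `L_{k,t}`: the complete bipartite graph `K_{2,t+1}` and one more vertex
`y^*` (the vertex `none`) joined by `k - t - 1` edges to each vertex of `X`. -/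
def multL (k t : ℕ) : Fin 2 → Option (Fin (t + 1)) → ℕ
  | _, some _ => 1
  | _, none => k - t - 1

/-- The graph `L_{k,t}`. -/
def graphL (k t : ℕ) : Bigraph (Fin 2) (Option (Fin (t + 1))) (MultEdge (multL k t)) := ofMult (multL k t)

/-- Multiplicities of `G_7`: the 6-cycle in which `x_i` is adjacent to `y_i` and `y_{i+1}`
(indices modulo `3`), and one more vertex `y^*` (the vertex `none`) adjacent to each vertex
of `X`. -/
def mult7 : Fin 3 → Option (Fin 3) → ℕ
  | i, some j => if j = i ∨ j = i + 1 then 1 else 0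
  | _, none => 1

/-- The graph `G_7`. -/
def graph7 : Bigraph (Fin 3) (Option (Fin 3)) (MultEdge mult7) := ofMult mult7

end Constructions

end Bigraph

/-! Under Hall's Condition the maximum matchings are those that cover `X`, so their number is the
nonzero permanent of the matrix of multiplicities with rows `X` and columns `Y`
(`numMaxMatchings_eq`). Everything then becomes a lower bound for `per` in terms of row sums, column
sums and the excess `t` of columns over rows.

The basic dichotomy is whether a tight set of rows exists. If it does, the permanent factors into a
square block that keeps its row sums, worth at least `k`, and a remainder that keeps its column sums
and the excess, worth `t + 1`, or `2 (t + 1)` if all column sums are at least 2. If there is none,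
every entry extends to a full transversal (`per_erase_ne_zero`), and one expands along a row `r`. If
each column meets another row too, all minors are at least `t + 1`, which gives `k (t + 1)`. If `r`
has `p` private columns, met by no other row, then deleting them with `r` leaves excess `t + 1 - p`;
induction on the rows, starting from the bound `k + t` for two rows, gives `k (t + 1)` again
(`mul_succ_le_per`).

For column sums at least 2, four or more rows are reduced to three by merging two rows along a
column (`per_merge_le`), unless an expansion gives the bound directly. Three rows, one of them with
a private column, are treated by spreading the permanent over the columns. Three rows without
private columns or tight sets have permanent at least `(s - 4)(t + 1)`, where `s` is the sum of all
entries (`Spread.mul_le_per`): units are removed until each column consists of two ones and a zero,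
where the permanent is explicit. Since `s ≥ 3k`, this suffices for `k ≥ 4`; for `k = 3` it falls
short only if `s = 9`, which is the source of the `- 1`. -/

namespace Bigraph

/-! ### Permanents of rectangular matrices, tight sets of rows. -/

section Permanent

variable {Y : Type*}

/-- The sum of the column `y`. -/
def col (L : List (Y → ℕ)) (y : Y) : ℕ := (L.map (fun r => r y)).sum

@[simp] lemma col_nil (y : Y) : col [] y = 0 := rfl

@[simp] lemma col_cons (r : Y → ℕ) (L : List (Y → ℕ)) (y : Y) :
    col (r :: L) y = r y + col L y := by simp [col]

@[simp] lemma col_append (L L' : List (Y → ℕ)) (y : Y) :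
    col (L ++ L') y = col L y + col L' y := by simp [col]

lemma col_perm {L L' : List (Y → ℕ)} (h : L.Perm L') (y : Y) : col L y = col L' y :=
  (h.map _).sum_eq

lemma col_eq_zero_iff {L : List (Y → ℕ)} {y : Y} : col L y = 0 ↔ ∀ r ∈ L, r y = 0 := by
  simp [col, List.sum_eq_zero_iff]

/-- The columns in `T` in which `L` does not vanish. -/
def cols (L : List (Y → ℕ)) (T : Finset Y) : Finset Y := T.filter fun y => col L y ≠ 0

lemma mem_cols {L : List (Y → ℕ)} {T : Finset Y} {y : Y} :
    y ∈ cols L T ↔ y ∈ T ∧ col L y ≠ 0 := by simp [cols]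

lemma cols_subset (L : List (Y → ℕ)) (T : Finset Y) : cols L T ⊆ T := Finset.filter_subset _ _

lemma one_le_col_of_mem_cols {L : List (Y → ℕ)} {T : Finset Y} :
    ∀ y ∈ cols L T, 1 ≤ col L y := fun _ hy => Nat.one_le_iff_ne_zero.2 (mem_cols.1 hy).2

/-- A proper nonempty set `L₁` of rows is tight if it vanishes outside as many columns as it has
rows. -/
def Tight (L : List (Y → ℕ)) (T : Finset Y) : Prop :=
  ∃ (L₁ L₂ : List (Y → ℕ)) (T₁ : Finset Y), L₁ ≠ [] ∧ L₂ ≠ [] ∧ L.Perm (L₁ ++ L₂) ∧ T₁ ⊆ T ∧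
    T₁.card = L₁.length ∧ ∀ r ∈ L₁, ∀ y ∈ T, r y ≠ 0 → y ∈ T₁

lemma Tight.perm {L L' : List (Y → ℕ)} {T : Finset Y} (h : L.Perm L') (ht : Tight L T) :
    Tight L' T := by
  obtain ⟨L₁, L₂, T₁, h₁, h₂, hp, h'⟩ := ht
  exact ⟨L₁, L₂, T₁, h₁, h₂, h.symm.trans hp, h'⟩

lemma perm_map_get (L : List (Y → ℕ)) (S : Finset (Fin L.length)) :
    L.Perm (S.toList.map L.get ++ Sᶜ.toList.map L.get) := by
  rw [← List.map_append]
  have h1 : (List.finRange L.length).Perm (S.toList ++ Sᶜ.toList) := by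
    rw [List.perm_ext_iff_of_nodup (List.nodup_finRange _)]
    · intro a
      simp [em]
    · rw [List.nodup_append]
      refine ⟨S.nodup_toList, Sᶜ.nodup_toList, fun a ha b hb hab => ?_⟩
      subst hab
      simp at ha hb
      exact hb ha
  have h2 := h1.map L.get
  rwa [List.map_get_finRange] at h2

variable [DecidableEq Y]

/-- The permanent of the matrix with the rows `L` and the set of columns `T`: the number of ways
to choose, for each row in turn, an entry in a new column, counted with weights. -/
def per : List (Y → ℕ) → Finset Y → ℕ
  | [], _ => 1
  | r :: L, T => ∑ y ∈ T, r y * per L (T.erase y)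

@[simp] lemma per_nil (T : Finset Y) : per [] T = 1 := rfl

lemma per_cons (r : Y → ℕ) (L : List (Y → ℕ)) (T : Finset Y) :
    per (r :: L) T = ∑ y ∈ T, r y * per L (T.erase y) := rfl

lemma per_swap (r s : Y → ℕ) (L : List (Y → ℕ)) (T : Finset Y) :
    per (r :: s :: L) T = per (s :: r :: L) T := by
  simp only [per_cons, Finset.mul_sum]
  rw [Finset.sum_comm' (t' := T) (s' := fun y => T.erase y)]
  · refine Finset.sum_congr rfl fun y _ => Finset.sum_congr rfl fun z _ => ?_
    rw [Finset.erase_right_comm]; ring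
  · intro x y
    simp only [Finset.mem_erase]
    tauto

lemma per_perm {L L' : List (Y → ℕ)} (h : L.Perm L') (T : Finset Y) : per L T = per L' T := by
  induction h generalizing T with
  | nil => rfl
  | cons r _ ih => simp only [per_cons, ih]
  | swap r s L => exact per_swap _ _ _ _
  | trans _ _ ih₁ ih₂ => rw [ih₁, ih₂]

lemma per_mono (L : List (Y → ℕ)) {S T : Finset Y} (h : S ⊆ T) : per L S ≤ per L T := by
  induction L generalizing S T with
  | nil => simp
  | cons r L ih =>
    rw [per_cons, per_cons]
    refine (Finset.sum_le_sum fun y _ => Nat.mul_le_mul_left _ (ih (Finset.erase_subset_erase y h))).trans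
      (Finset.sum_le_sum_of_subset h)

/-- Columns that vanish can be dropped. -/
lemma per_eq_of_col_eq_zero (L : List (Y → ℕ)) {S T : Finset Y} (h : S ⊆ T)
    (h0 : ∀ y ∈ T, y ∉ S → col L y = 0) : per L T = per L S := by
  induction L generalizing S T with
  | nil => simp
  | cons r L ih =>
    rw [per_cons, per_cons]
    have h0' : ∀ y ∈ T, y ∉ S → r y = 0 ∧ col L y = 0 := fun y hy hS => by
      have := h0 y hy hS
      simpa using this
    rw [← Finset.sum_subset h]
    · refine Finset.sum_congr rfl fun y _ => ?_
      rw [ih (Finset.erase_subset_erase y h)]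
      intro z hz hz'
      simp only [Finset.mem_erase, not_and] at hz hz'
      exact (h0' z hz.2 (hz' hz.1)).2
    · intro y hy hS
      simp [(h0' y hy hS).1]

lemma length_le_card_of_per_ne_zero {L : List (Y → ℕ)} {T : Finset Y} (h : per L T ≠ 0) :
    L.length ≤ T.card := by
  induction L generalizing T with
  | nil => simp
  | cons r L ih =>
    obtain ⟨y, hy, hne⟩ := Finset.exists_ne_zero_of_sum_ne_zero h
    have := ih (right_ne_zero_of_mul hne)
    rw [Finset.card_erase_of_mem hy] at this
    have := Finset.card_pos.2 ⟨y, hy⟩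
    simp only [List.length_cons]; omega

lemma exists_edge_of_per_ne_zero {r : Y → ℕ} {L : List (Y → ℕ)} {T : Finset Y}
    (h : per (r :: L) T ≠ 0) : ∃ y ∈ T, r y ≠ 0 ∧ per L (T.erase y) ≠ 0 := by
  obtain ⟨y, hy, hne⟩ := Finset.exists_ne_zero_of_sum_ne_zero h
  exact ⟨y, hy, left_ne_zero_of_mul hne, right_ne_zero_of_mul hne⟩

lemma per_tail_ne_zero {r : Y → ℕ} {L : List (Y → ℕ)} {T : Finset Y}
    (h : per (r :: L) T ≠ 0) : per L T ≠ 0 := by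
  obtain ⟨y, _, _, hne⟩ := exists_edge_of_per_ne_zero h
  have := per_mono L (Finset.erase_subset y T)
  omega

lemma per_cols (L : List (Y → ℕ)) (T : Finset Y) : per L (cols L T) = per L T := by
  refine (per_eq_of_col_eq_zero L (cols_subset L T) fun y hy hy' => ?_).symm
  by_contra h
  exact hy' (mem_cols.2 ⟨hy, h⟩)

lemma per_erase_cols (L : List (Y → ℕ)) (T : Finset Y) (y : Y) :
    per L ((cols L T).erase y) = per L (T.erase y) := by
  refine (per_eq_of_col_eq_zero L (Finset.erase_subset_erase y (cols_subset L T))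
    fun z hz hz' => ?_).symm
  by_contra h
  rw [Finset.mem_erase] at hz hz'
  exact hz' ⟨hz.1, mem_cols.2 ⟨hz.2, h⟩⟩

/-- Expansion along a row, with the columns met by that row only grouped together. -/
lemma per_cons_eq (r : Y → ℕ) (L : List (Y → ℕ)) (T : Finset Y) :
    per (r :: L) T = (∑ y ∈ T \ cols L T, r y) * per L (cols L T) +
      ∑ y ∈ cols L T, r y * per L ((cols L T).erase y) := by
  rw [per_cons, ← Finset.sum_sdiff (cols_subset L T), Finset.sum_mul]
  congr 1
  · refine Finset.sum_congr rfl fun y hy => ?_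
    rw [per_cols]
    congr 1
    refine (per_eq_of_col_eq_zero L (Finset.erase_subset y T) fun z hz hz' => ?_).symm
    have : z = y := by
      by_contra h
      exact hz' (Finset.mem_erase.2 ⟨h, hz⟩)
    subst this
    by_contra h
    exact (Finset.mem_sdiff.1 hy).2 (mem_cols.2 ⟨hz, h⟩)
  · exact Finset.sum_congr rfl fun y _ => by rw [per_erase_cols]

/-- The rows `L₁` use up all of `T₁`, whatever they choose, so `L₂` always chooses from `T \ T₁`. -/
lemma per_append_of_tight {L₁ L₂ : List (Y → ℕ)} {T₁ T : Finset Y} (hT : T₁ ⊆ T)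
    (hc : T₁.card = L₁.length) (h : ∀ r ∈ L₁, ∀ y ∈ T, r y ≠ 0 → y ∈ T₁) :
    per (L₁ ++ L₂) T = per L₁ T₁ * per L₂ (T \ T₁) := by
  induction L₁ generalizing T T₁ with
  | nil =>
    have : T₁ = ∅ := Finset.card_eq_zero.1 (by simpa using hc)
    simp [this]
  | cons r L ih =>
    rw [List.cons_append, per_cons, per_cons, Finset.sum_mul, ← Finset.sum_subset hT]
    · refine Finset.sum_congr rfl fun y hy => ?_
      rw [ih (Finset.erase_subset_erase y hT)]
      · have : T.erase y \ T₁.erase y = T \ T₁ := by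
          ext z
          simp only [Finset.mem_sdiff, Finset.mem_erase]
          constructor
          · rintro ⟨⟨h1, h2⟩, h3⟩
            exact ⟨h2, fun h4 => h3 ⟨h1, h4⟩⟩
          · rintro ⟨h1, h2⟩
            exact ⟨⟨fun h3 => h2 (h3 ▸ hy), h1⟩, fun h3 => h2 h3.2⟩
        rw [this, mul_assoc]
      · rw [Finset.card_erase_of_mem hy, hc]; simp
      · intro s hs z hz hne
        rw [Finset.mem_erase] at hz ⊢
        exact ⟨hz.1, h s (List.mem_cons_of_mem _ hs) z hz.2 hne⟩
    · intro y hy hy'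
      have : r y = 0 := by
        by_contra h0
        exact hy' (h r List.mem_cons_self y hy h0)
      simp [this]

/-- This form is the one to which Hall's marriage theorem applies. -/
lemma per_ne_zero_iff {L : List (Y → ℕ)} {T : Finset Y} :
    per L T ≠ 0 ↔ ∃ f : Fin L.length → Y, Function.Injective f ∧
      ∀ i, f i ∈ T.filter fun y => L.get i y ≠ 0 := by
  induction L generalizing T with
  | nil =>
    simp only [per_nil, ne_eq, one_ne_zero, not_false_eq_true, true_iff]
    exact ⟨fun i => i.elim0, fun i => i.elim0, fun i => i.elim0⟩
  | cons r L ih =>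
    constructor
    · intro h
      obtain ⟨y, hy, hr, hne⟩ := exists_edge_of_per_ne_zero h
      obtain ⟨f, hf, hfm⟩ := ih.1 hne
      simp only [Finset.mem_filter, Finset.mem_erase] at hfm
      refine ⟨Fin.cons y f, ?_, ?_⟩
      · rw [Fin.cons_injective_iff]
        refine ⟨?_, hf⟩
        rintro ⟨i, hi⟩
        exact (hfm i).1.1 hi
      · intro i
        refine Fin.cases ?_ (fun i => ?_) i
        · exact Finset.mem_filter.2 ⟨hy, hr⟩
        · exact Finset.mem_filter.2 ⟨(hfm i).1.2, (hfm i).2⟩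
    · rintro ⟨f, hf, hfm⟩
      have h1 : per L (T.erase (f 0)) ≠ 0 := by
        refine ih.2 ⟨fun i => f i.succ, fun i j hij => Fin.succ_injective _ (hf hij), fun i => ?_⟩
        have := hfm i.succ
        simp only [Finset.mem_filter, Finset.mem_erase] at this ⊢
        exact ⟨⟨fun h => Fin.succ_ne_zero i (hf h), this.1⟩, this.2⟩
      have h0 := hfm 0
      simp only [Finset.mem_filter] at h0
      rw [per_cons]
      intro hs
      have := (Finset.sum_eq_zero_iff.1 hs) (f 0) h0.1
      rcases Nat.mul_eq_zero.1 this with h | h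
      · exact h0.2 h
      · exact h1 h

/-- If there is no tight set, then every entry extends to a full choice. -/
lemma per_erase_ne_zero {r : Y → ℕ} {L : List (Y → ℕ)} {T : Finset Y}
    (h : per (r :: L) T ≠ 0) (ht : ¬ Tight (r :: L) T) (y : Y) : per L (T.erase y) ≠ 0 := by
  intro h0
  apply ht
  have hL := per_tail_ne_zero h
  rw [per_ne_zero_iff, ← Finset.all_card_le_biUnion_card_iff_exists_injective] at hL
  have h0' : ¬ per L (T.erase y) ≠ 0 := not_not.2 h0
  rw [per_ne_zero_iff, ← Finset.all_card_le_biUnion_card_iff_exists_injective] at h0'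
  push Not at h0'
  -- Hall's Condition holds for `L` in `T` but fails for `S` once `y` is removed. Only one neighbour
  -- is lost, so `S` has exactly `S.card` neighbours in `T`: it is tight, with `r` in its
  -- complement.
  obtain ⟨S, hS⟩ := h0'
  set T₁ := S.biUnion fun i => T.filter fun y => L.get i y ≠ 0 with hT₁
  refine ⟨S.toList.map L.get, r :: Sᶜ.toList.map L.get, T₁, ?_, by simp, ?_, ?_, ?_, ?_⟩
  · intro hn
    have : S = ∅ := by simpa using hn
    simp [this] at hS
  · exact ((perm_map_get L S).cons r).trans List.perm_middle.symm
  · intro z hz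
    simp only [hT₁, Finset.mem_biUnion, Finset.mem_filter] at hz
    obtain ⟨i, _, hz, _⟩ := hz
    exact hz
  · have h1 : S.card ≤ T₁.card := hL S
    have h2 : T₁.card ≤ (S.biUnion fun i => (T.erase y).filter fun y => L.get i y ≠ 0).card + 1 := by
      refine (Finset.card_le_card (t := insert y _) ?_).trans (Finset.card_insert_le _ _)
      intro z hz
      simp only [hT₁, Finset.mem_biUnion, Finset.mem_filter] at hz
      simp only [Finset.mem_insert, Finset.mem_biUnion, Finset.mem_filter, Finset.mem_erase]
      obtain ⟨i, hi, hz, hne⟩ := hz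
      by_cases hzy : z = y
      · exact Or.inl hzy
      · exact Or.inr ⟨i, hi, ⟨hzy, hz⟩, hne⟩
    simp only [List.length_map, Finset.length_toList]
    omega
  · intro s hs z hz hne
    simp only [List.mem_map, Finset.mem_toList] at hs
    obtain ⟨i, hi, rfl⟩ := hs
    simp only [hT₁, Finset.mem_biUnion, Finset.mem_filter]
    exact ⟨i, hi, hz, hne⟩

/-- If there is no tight set, then a row has an entry outside any given column. -/
lemma exists_ne_of_not_tight {r : Y → ℕ} {L : List (Y → ℕ)} {T : Finset Y}
    (h : per (r :: L) T ≠ 0) (ht : ¬ Tight (r :: L) T) (hL : L ≠ []) (y : Y) :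
    ∃ z ∈ T, z ≠ y ∧ r z ≠ 0 := by
  by_contra hno
  push Not at hno
  obtain ⟨z, hz, hr, _⟩ := exists_edge_of_per_ne_zero h
  have hzy : z = y := by
    by_contra hne
    exact hr (hno z hz hne)
  subst hzy
  -- A row that meets a single column is tight by itself.
  refine ht ⟨[r], L, {z}, by simp, hL, by simp, by simpa using hz, by simp, ?_⟩
  intro s hs w hw hne
  simp only [List.mem_singleton] at hs
  subst hs
  rw [Finset.mem_singleton]
  by_contra h'
  exact hne (hno w hw h')

end Permanent

/-! ### Bounds from tight sets and private columns. -/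

section LowerBounds

variable {Y : Type*} [DecidableEq Y]

/-- The square factor inherits the row sums, the other factor inherits the column sums and the
excess `t`; hypotheses on rows and on columns are therefore used on different factors. -/
lemma Tight.exists_factors {L : List (Y → ℕ)} {T : Finset Y} {t : ℕ} (ht : Tight L T)
    (hT : T.card = L.length + t) :
    ∃ (L₁ L₂ : List (Y → ℕ)) (T₁ : Finset Y), L₁ ≠ [] ∧ L₂ ≠ [] ∧ L.Perm (L₁ ++ L₂) ∧
      per L T = per L₁ T₁ * per L₂ (T \ T₁) ∧ T₁.card = L₁.length ∧
      (T \ T₁).card = L₂.length + t ∧ (∀ r ∈ L₁, ∑ y ∈ T₁, r y = ∑ y ∈ T, r y) ∧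
      ∀ y ∈ T \ T₁, col L₂ y = col L y := by
  obtain ⟨L₁, L₂, T₁, h₁, h₂, hp, hsub, hc, hz⟩ := ht
  refine ⟨L₁, L₂, T₁, h₁, h₂, hp, ?_, hc, ?_, ?_, ?_⟩
  · rw [per_perm hp, per_append_of_tight hsub hc hz]
  · have := hp.length_eq
    rw [Finset.card_sdiff_of_subset hsub, hT, hc, this, List.length_append]
    omega
  · intro r hr
    refine Finset.sum_subset hsub fun y hy hy' => ?_
    by_contra h
    exact hy' (hz r hr y hy h)
  · intro y hy
    rw [Finset.mem_sdiff] at hy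
    rw [col_perm hp, col_append, col_eq_zero_iff (L := L₁) |>.2, zero_add]
    intro r hr
    by_contra h
    exact hy.2 (hz r hr y hy.1 h)

/-- `T \ cols L T` consists of the private columns of `r`, whose whole column sum comes from `r`. -/
lemma card_sdiff_cols_le {r : Y → ℕ} {L : List (Y → ℕ)} {T : Finset Y} {c : ℕ}
    (hcol : ∀ y ∈ T, c ≤ col (r :: L) y) :
    c * (T \ cols L T).card ≤ ∑ y ∈ T \ cols L T, r y := by
  rw [mul_comm, ← smul_eq_mul, ← Finset.sum_const]
  refine Finset.sum_le_sum fun y hy => ?_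
  rw [Finset.mem_sdiff, mem_cols] at hy
  have h0 : col L y = 0 := by
    by_contra h
    exact hy.2 ⟨hy.1, h⟩
  have := hcol y hy.1
  rw [col_cons, h0] at this
  simpa using this

lemma per_cols_ne_zero {r : Y → ℕ} {L : List (Y → ℕ)} {T : Finset Y}
    (h : per (r :: L) T ≠ 0) : per L (cols L T) ≠ 0 := by
  rw [per_cols]; exact per_tail_ne_zero h

lemma card_sdiff_cols_add (L : List (Y → ℕ)) (T : Finset Y) :
    (T \ cols L T).card + (cols L T).card = T.card :=
  Finset.card_sdiff_add_card_eq_card (cols_subset L T)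

lemma cols_eq_of_card_sdiff_eq_zero {L : List (Y → ℕ)} {T : Finset Y}
    (h : (T \ cols L T).card = 0) : cols L T = T :=
  (cols_subset L T).antisymm (Finset.sdiff_eq_empty_iff_subset.1 (Finset.card_eq_zero.1 h))

/-- Without private columns, one extendable entry of `r` is fixed and its row and column are
deleted. With `p` private columns, each of them multiplies the permanent of the other rows. -/
lemma card_lt_per_add_length {L : List (Y → ℕ)} {T : Finset Y} (h : per L T ≠ 0)
    (hcol : ∀ y ∈ T, 1 ≤ col L y) : T.card + 1 ≤ per L T + L.length := by
  induction L generalizing T with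
  | nil =>
    have : T = ∅ := Finset.eq_empty_of_forall_notMem fun y hy => by simpa using hcol y hy
    simp [this]
  | cons r L ih =>
    have hp := card_sdiff_cols_le hcol
    have hc := card_sdiff_cols_add L T
    rcases Nat.eq_zero_or_pos (T \ cols L T).card with h0 | h0
    · have hZ := cols_eq_of_card_sdiff_eq_zero h0
      obtain ⟨y, hy, hr, hne⟩ := exists_edge_of_per_ne_zero h
      have hle : per L (T.erase y) ≤ per (r :: L) T := by
        rw [per_cons]
        refine le_trans ?_ (Finset.single_le_sum (fun _ _ => Nat.zero_le _) hy)
        exact Nat.le_mul_of_pos_left _ (Nat.pos_of_ne_zero hr)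
      have := ih hne fun z hz => by
        rw [Finset.mem_erase] at hz
        exact one_le_col_of_mem_cols z (hZ.symm ▸ hz.2)
      rw [Finset.card_erase_of_mem hy] at this
      have := Finset.card_pos.2 ⟨y, hy⟩
      simp only [List.length_cons]
      omega
    · have hne := per_cols_ne_zero h
      have h1 := ih hne one_le_col_of_mem_cols
      have h2 : (T \ cols L T).card * per L (cols L T) ≤ per (r :: L) T := by
        rw [per_cons_eq]
        exact (Nat.mul_le_mul_right _ (by simpa using hp)).trans (Nat.le_add_right _ _)
      -- This is `(p - 1) * (Φ - 1) ≥ 0` for the number `p` of private columns and the permanent `Φ`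
      -- of the rest.
      have h3 : (T \ cols L T).card + per L (cols L T) ≤
          (T \ cols L T).card * per L (cols L T) + 1 := by
        have := Nat.pos_of_ne_zero hne
        nlinarith
      simp only [List.length_cons]
      omega

lemma succ_le_per {L : List (Y → ℕ)} {T : Finset Y} {t : ℕ} (h : per L T ≠ 0)
    (hT : T.card = L.length + t) (hcol : ∀ y ∈ T, 1 ≤ col L y) : t + 1 ≤ per L T := by
  have := card_lt_per_add_length h hcol
  omega

/-- If each minor of a row has permanent at least `m`, then the permanent is at least `m` times
the row sum. -/
lemma mul_le_per_cons {r : Y → ℕ} {L : List (Y → ℕ)} {T : Finset Y} {k m : ℕ}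
    (hr : k ≤ ∑ y ∈ T, r y) (hm : ∀ y ∈ T, r y ≠ 0 → m ≤ per L (T.erase y)) :
    k * m ≤ per (r :: L) T := by
  refine (Nat.mul_le_mul_right m hr).trans ?_
  rw [Finset.sum_mul, per_cons]
  refine Finset.sum_le_sum fun y hy => ?_
  by_cases h0 : r y = 0
  · simp [h0]
  · exact Nat.mul_le_mul_left _ (hm y hy h0)

/-- Without a tight set each of the `k` units of a row extends to a transversal. Otherwise the
square block of a tight set already has permanent at least `k`, by induction. -/
lemma le_per_of_le_row {L : List (Y → ℕ)} {T : Finset Y} {k : ℕ} (h : per L T ≠ 0)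
    (hL : L ≠ []) (hT : T.card = L.length) (hrow : ∀ r ∈ L, k ≤ ∑ y ∈ T, r y) :
    k ≤ per L T := by
  induction hn : L.length using Nat.strong_induction_on generalizing L T with
  | _ n ih =>
    by_cases ht : Tight L T
    · obtain ⟨L₁, L₂, T₁, h₁, h₂, hp, hf, hc₁, -, hs, -⟩ :=
        ht.exists_factors (t := 0) (by simpa using hT)
      rw [hf] at h ⊢
      have hlen := hp.length_eq
      rw [List.length_append] at hlen
      have := List.length_pos_iff.2 h₂
      have := ih L₁.length (by omega) (left_ne_zero_of_mul h) h₁ hc₁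
        (fun r hr => by rw [hs r hr]; exact hrow r (hp.mem_iff.2 (by simp [hr]))) rfl
      exact this.trans (Nat.le_mul_of_pos_right _ (Nat.pos_of_ne_zero (right_ne_zero_of_mul h)))
    · obtain _ | ⟨r, L⟩ := L
      · exact absurd rfl hL
      · simpa using mul_le_per_cons (m := 1) (hrow r (by simp)) fun y _ _ =>
          Nat.pos_of_ne_zero (per_erase_ne_zero h ht y)

lemma mul_le_per_of_tight {L : List (Y → ℕ)} {T : Finset Y} {k t : ℕ} (h : per L T ≠ 0)
    (hT : T.card = L.length + t) (hrow : ∀ r ∈ L, k ≤ ∑ y ∈ T, r y)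
    (hcol : ∀ y ∈ T, 1 ≤ col L y) (ht : Tight L T) : k * (t + 1) ≤ per L T := by
  obtain ⟨L₁, L₂, T₁, h₁, h₂, hp, hf, hc₁, hc₂, hs, hs₂⟩ := ht.exists_factors hT
  rw [hf] at h ⊢
  refine Nat.mul_le_mul (le_per_of_le_row (left_ne_zero_of_mul h) h₁ hc₁ fun r hr => ?_)
    (succ_le_per (right_ne_zero_of_mul h) hc₂ fun y hy => ?_)
  · rw [hs r hr]; exact hrow r (hp.mem_iff.2 (by simp [hr]))
  · rw [hs₂ y hy]; exact hcol y (Finset.mem_sdiff.1 hy).1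

/-- The difference of the two sides is `(p - 1) * (t + 1 - p)`. -/
lemma add_one_le_mul {p t : ℕ} (h1 : 1 ≤ p) (h2 : p ≤ t + 1) : t + 1 ≤ p * (t + 2 - p) := by
  obtain ⟨q, rfl⟩ := Nat.exists_eq_add_of_le h1
  obtain ⟨s, hs⟩ := Nat.exists_eq_add_of_le h2
  have : t + 2 - (1 + q) = s + 1 := by omega
  rw [this]
  have : t + 1 = 1 + q + s := hs
  rw [this]
  nlinarith

/-- The excess of columns after removal of a row and the columns met by that row only. -/
lemma card_cols_eq {r : Y → ℕ} {L : List (Y → ℕ)} {T : Finset Y} {t : ℕ}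
    (h : per (r :: L) T ≠ 0) (hT : T.card = (r :: L).length + t) :
    (T \ cols L T).card ≤ t + 1 ∧
      (cols L T).card = L.length + (t + 1 - (T \ cols L T).card) := by
  have h1 := length_le_card_of_per_ne_zero (per_cols_ne_zero h)
  have h2 := card_sdiff_cols_add L T
  rw [List.length_cons] at hT
  omega

lemma succ_le_per_erase {r : Y → ℕ} {L : List (Y → ℕ)} {T : Finset Y} {t : ℕ}
    (h : per (r :: L) T ≠ 0) (hT : T.card = (r :: L).length + t) (ht : ¬ Tight (r :: L) T)
    (hZ : (T \ cols L T).card = 0) {y : Y} (hy : y ∈ T) : t + 1 ≤ per L (T.erase y) := by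
  refine succ_le_per (per_erase_ne_zero h ht y) ?_ fun z hz => ?_
  · rw [Finset.card_erase_of_mem hy, hT, List.length_cons]
    omega
  · exact one_le_col_of_mem_cols (T := T) z
      ((cols_eq_of_card_sdiff_eq_zero hZ).symm ▸ Finset.mem_of_mem_erase hz)

/-- A row without private columns meets at least two columns, and each of the two minors is at least
`t + 1`. With `p` private columns the bound is `2 * p * (t + 2 - p)`. -/
lemma two_mul_succ_le_per {L : List (Y → ℕ)} {T : Finset Y} {t : ℕ} (h : per L T ≠ 0)
    (hL : L ≠ []) (hT : T.card = L.length + t) (hcol : ∀ y ∈ T, 2 ≤ col L y) :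
    2 * (t + 1) ≤ per L T := by
  induction hn : L.length using Nat.strong_induction_on generalizing L T with
  | _ n ih =>
    by_cases ht : Tight L T
    · obtain ⟨L₁, L₂, T₁, h₁, h₂, hp, hf, hc₁, hc₂, hs, hs₂⟩ := ht.exists_factors hT
      rw [hf] at h ⊢
      have hlen := hp.length_eq
      rw [List.length_append] at hlen
      have := List.length_pos_iff.2 h₁
      have := ih L₂.length (by omega) (right_ne_zero_of_mul h) h₂ hc₂
        (fun y hy => by rw [hs₂ y hy]; exact hcol y (Finset.mem_sdiff.1 hy).1) rfl
      exact this.trans (Nat.le_mul_of_pos_left _ (Nat.pos_of_ne_zero (left_ne_zero_of_mul h)))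
    · obtain _ | ⟨r, L⟩ := L
      · exact absurd rfl hL
      obtain ⟨hp, hc⟩ := card_cols_eq h hT
      rcases Nat.eq_zero_or_pos (T \ cols L T).card with h0 | h0
      · refine mul_le_per_cons ?_ fun y hy _ => succ_le_per_erase h hT ht h0 hy
        have hL' : L ≠ [] := by
          rintro rfl
          have := length_le_card_of_per_ne_zero h
          obtain ⟨y, hy⟩ := Finset.card_pos.1 (this.trans_lt' (by simp))
          have : y ∈ cols [] T := (cols_eq_of_card_sdiff_eq_zero h0).symm ▸ hy
          simp [mem_cols] at this
        obtain ⟨y, hy, hry, -⟩ := exists_edge_of_per_ne_zero h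
        obtain ⟨z, hz, hzy, hrz⟩ := exists_ne_of_not_tight h ht hL' y
        rw [← Finset.add_sum_erase T r hy, ← Finset.add_sum_erase _ r (Finset.mem_erase.2 ⟨hzy, hz⟩)]
        omega
      · have h1 := succ_le_per (per_cols_ne_zero h) hc one_le_col_of_mem_cols
        have h2 := add_one_le_mul h0 hp
        rw [per_cons_eq]
        refine le_trans ?_ (Nat.le_add_right _ _)
        refine le_trans ?_ (Nat.mul_le_mul (card_sdiff_cols_le hcol) h1)
        have : t + 1 - (T \ cols L T).card + 1 = t + 2 - (T \ cols L T).card := by omega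
        rw [this]
        nlinarith

/-! ### Two rows -/

lemma per_single (a : Y → ℕ) (T : Finset Y) : per [a] T = ∑ y ∈ T, a y := by simp [per_cons]

lemma per_pair_add (a b : Y → ℕ) (T : Finset Y) :
    per [a, b] T + ∑ y ∈ T, a y * b y = (∑ y ∈ T, a y) * ∑ y ∈ T, b y := by
  rw [per_cons, ← Finset.sum_add_distrib, Finset.sum_mul]
  refine Finset.sum_congr rfl fun y hy => ?_
  rw [per_single, ← Finset.add_sum_erase T b hy]
  ring

lemma sum_mul_le_mul_sum (a b : Y → ℕ) (S : Finset Y) :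
    ∑ y ∈ S, a y * b y ≤ (∑ y ∈ S, a y) * ∑ y ∈ S, b y := by
  have := per_pair_add a b S
  omega

end LowerBounds

/-! ### Two rows, and the bound `k (t + 1)` for three or more. -/

section Pairs

variable {Y : Type*}

/-- The columns that both rows meet. -/
def shared (a b : Y → ℕ) (T : Finset Y) : Finset Y := T.filter fun y => a y ≠ 0 ∧ b y ≠ 0

lemma shared_comm (a b : Y → ℕ) (T : Finset Y) : shared a b T = shared b a T := by
  ext y; simp [shared, and_comm]

lemma card_shared_le (a b : Y → ℕ) (T : Finset Y) :
    (shared a b T).card ≤ ∑ y ∈ shared a b T, a y := by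
  rw [Finset.card_eq_sum_ones]
  refine Finset.sum_le_sum fun y hy => ?_
  simp only [shared, Finset.mem_filter] at hy
  omega

lemma sum_mul_eq_sum_shared (a b : Y → ℕ) (T : Finset Y) :
    ∑ y ∈ T, a y * b y = ∑ y ∈ shared a b T, a y * b y := by
  symm
  refine Finset.sum_subset (Finset.filter_subset _ _) fun y hy hy' => ?_
  simp only [shared, Finset.mem_filter] at hy'
  by_contra h
  exact hy' ⟨hy, left_ne_zero_of_mul h, right_ne_zero_of_mul h⟩

variable [DecidableEq Y]

lemma mem_sdiff_cols_single {b : Y → ℕ} {T : Finset Y} {y : Y} :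
    y ∈ T \ cols [b] T ↔ y ∈ T ∧ b y = 0 := by
  simp only [Finset.mem_sdiff, mem_cols, col_cons, col_nil]
  tauto

lemma sum_eq_private_add_shared (a b : Y → ℕ) (T : Finset Y) :
    ∑ y ∈ T, a y = ∑ y ∈ T \ cols [b] T, a y + ∑ y ∈ shared a b T, a y := by
  rw [← Finset.sum_sdiff (cols_subset [b] T)]
  congr 1
  symm
  refine Finset.sum_subset (fun y hy => ?_) fun y hy hy' => ?_
  · simp only [shared, Finset.mem_filter] at hy
    simp [mem_cols, hy.1, hy.2.2]
  · simp only [shared, Finset.mem_filter, mem_cols, col_cons, col_nil] at hy hy'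
    tauto

lemma card_eq_private_add_shared {a b : Y → ℕ} {T : Finset Y} (hcol : ∀ y ∈ T, 1 ≤ a y + b y) :
    T.card = (T \ cols [b] T).card + (T \ cols [a] T).card + (shared a b T).card := by
  rw [← Finset.card_union_of_disjoint, ← Finset.card_union_of_disjoint]
  · congr 1
    ext y
    simp only [Finset.mem_union, mem_sdiff_cols_single, shared, Finset.mem_filter]
    tauto
  · rw [Finset.disjoint_left]
    intro y hy
    simp only [Finset.mem_union, mem_sdiff_cols_single, shared, Finset.mem_filter] at hy ⊢
    tauto
  · rw [Finset.disjoint_left]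
    intro y hy hy'
    rw [mem_sdiff_cols_single] at hy hy'
    have := hcol y hy.1
    omega

/-- Since `a y * b y + 1 = a y + b y + (a y - 1) * (b y - 1)`, only the products of the reduced
entries need an estimate. -/
lemma sum_mul_add_card_le {a b : Y → ℕ} {Q : Finset Y} (h : ∀ y ∈ Q, a y ≠ 0 ∧ b y ≠ 0) :
    ∑ y ∈ Q, a y * b y + Q.card ≤ ∑ y ∈ Q, a y + ∑ y ∈ Q, b y +
      (∑ y ∈ Q, a y - Q.card) * (∑ y ∈ Q, b y - Q.card) := by
  have key : ∀ c : Y → ℕ, (∀ y ∈ Q, c y ≠ 0) → ∑ y ∈ Q, (c y - 1) + Q.card = ∑ y ∈ Q, c y := by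
    intro c hc
    rw [Finset.card_eq_sum_ones, ← Finset.sum_add_distrib]
    exact Finset.sum_congr rfl fun y hy => by have := hc y hy; omega
  have ha := key a fun y hy => (h y hy).1
  have hb := key b fun y hy => (h y hy).2
  have hab := sum_mul_le_mul_sum (fun y => a y - 1) (fun y => b y - 1) Q
  have : ∑ y ∈ Q, a y * b y + Q.card =
      ∑ y ∈ Q, a y + ∑ y ∈ Q, b y + ∑ y ∈ Q, (a y - 1) * (b y - 1) := by
    rw [Finset.card_eq_sum_ones, ← Finset.sum_add_distrib, ← Finset.sum_add_distrib,
      ← Finset.sum_add_distrib]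
    refine Finset.sum_congr rfl fun y hy => ?_
    obtain ⟨u, hu⟩ := Nat.exists_eq_succ_of_ne_zero (h y hy).1
    obtain ⟨v, hv⟩ := Nat.exists_eq_succ_of_ne_zero (h y hy).2
    simp only [hu, hv, Nat.succ_eq_add_one, Nat.add_sub_cancel]
    ring
  rw [this, ← ha, ← hb]
  simp only [Nat.add_sub_cancel]
  omega

lemma mul_le_per_of_no_private {r : Y → ℕ} {L : List (Y → ℕ)} {T : Finset Y} {k t : ℕ}
    (h : per (r :: L) T ≠ 0) (hT : T.card = (r :: L).length + t) (ht : ¬ Tight (r :: L) T)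
    (hZ : (T \ cols L T).card = 0) (hr : k ≤ ∑ y ∈ T, r y) : k * (t + 1) ≤ per (r :: L) T :=
  mul_le_per_cons hr fun _ hy _ => succ_le_per_erase h hT ht hZ hy

lemma add_le_mul_succ {k : ℕ} (t : ℕ) (hk : 1 ≤ k) : k + t ≤ k * (t + 1) := by nlinarith

/-- The excess enters additively because `k * (t + 1)` may fail for two rows: `(1, k - 1, 0)` and
`(0, k - 1, 1)` have permanent `2 * k - 1`. -/
lemma add_le_per_pair {a b : Y → ℕ} {T : Finset Y} {k t : ℕ} (h : per [a, b] T ≠ 0)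
    (hT : T.card = 2 + t) (hk : 1 ≤ k) (ha : k ≤ ∑ y ∈ T, a y) (hb : k ≤ ∑ y ∈ T, b y)
    (hcol : ∀ y ∈ T, 1 ≤ a y + b y) : k + t ≤ per [a, b] T := by
  have hcol' : ∀ y ∈ T, 1 ≤ col [a, b] y := fun y hy => by simpa using hcol y hy
  by_cases ht : Tight [a, b] T
  · exact (add_le_mul_succ t hk).trans
      (mul_le_per_of_tight h hT (by simp [ha, hb]) hcol' ht)
  rcases Nat.eq_zero_or_pos (T \ cols [b] T).card with h0 | h0
  · exact (add_le_mul_succ t hk).trans (mul_le_per_of_no_private h hT ht h0 ha)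
  rcases Nat.eq_zero_or_pos (T \ cols [a] T).card with h1 | h1
  · rw [per_swap] at h ⊢
    refine (add_le_mul_succ t hk).trans (mul_le_per_of_no_private h hT ?_ h1 hb)
    exact fun h' => ht (h'.perm (List.Perm.swap _ _ _))
  have hα := card_sdiff_cols_le hcol'
  have hβ := card_sdiff_cols_le (r := b) (L := [a]) (T := T) (c := 1)
    (fun y hy => by have := hcol y hy; simp; omega)
  have hc := card_eq_private_add_shared hcol
  have hsa := sum_eq_private_add_shared a b T
  have hsb := sum_eq_private_add_shared b a T
  have hqa := card_shared_le a b T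
  have hqb := card_shared_le b a T
  have hs := sum_mul_le_mul_sum a b (shared a b T)
  rw [← sum_mul_eq_sum_shared] at hs
  have hper := per_pair_add a b T
  rw [shared_comm b a] at hsb hqb
  rw [one_mul] at hα hβ
  generalize ∑ y ∈ T \ cols [b] T, a y = α at *
  generalize ∑ y ∈ T \ cols [a] T, b y = β at *
  generalize ∑ y ∈ shared a b T, a y = A at *
  generalize ∑ y ∈ shared a b T, b y = B at *
  rw [hsa] at hper ha
  rw [hsb] at hper hb
  -- Of the product of the two row sums, only the shared part `A * B` can be lost.
  have hlow : α * β + α * B + β * A ≤ per [a, b] T := by nlinarith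
  by_cases hk1 : k = 1
  · have := succ_le_per h hT hcol'
    omega
  rcases Nat.eq_zero_or_pos A with hA | hA
  · subst hA
    obtain ⟨α', rfl⟩ := Nat.exists_eq_add_of_le (show 2 ≤ α by omega)
    rcases Nat.eq_zero_or_pos B with hB | hB
    · subst hB
      obtain ⟨β', rfl⟩ := Nat.exists_eq_add_of_le (show 2 ≤ β by omega)
      nlinarith [Nat.zero_le (α' * β')]
    · obtain ⟨β', rfl⟩ := Nat.exists_eq_add_of_le (show 1 ≤ β by omega)
      nlinarith [Nat.zero_le (α' * β'), Nat.zero_le (α' * B)]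
  · obtain ⟨α', rfl⟩ := Nat.exists_eq_add_of_le (show 1 ≤ α by omega)
    obtain ⟨β', rfl⟩ := Nat.exists_eq_add_of_le (show 1 ≤ β by omega)
    obtain ⟨A', rfl⟩ := Nat.exists_eq_add_of_le (show 1 ≤ A by omega)
    nlinarith [Nat.zero_le (α' * β'), Nat.zero_le (α' * B), Nat.zero_le (β' * A')]

/-- `k (t + 1)` is a lower bound if there are at least three rows. -/
lemma mul_succ_le_per {L : List (Y → ℕ)} {T : Finset Y} {k t : ℕ} (h : per L T ≠ 0)
    (hL : 3 ≤ L.length) (hT : T.card = L.length + t) (hrow : ∀ r ∈ L, k ≤ ∑ y ∈ T, r y)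
    (hcol : ∀ y ∈ T, 1 ≤ col L y) : k * (t + 1) ≤ per L T := by
  induction hn : L.length using Nat.strong_induction_on generalizing L T t with
  | _ n ih =>
    rcases Nat.eq_zero_or_pos k with rfl | hk
    · simp
    by_cases ht : Tight L T
    · exact mul_le_per_of_tight h hT hrow hcol ht
    obtain _ | ⟨r, L⟩ := L
    · simp at hL
    obtain ⟨hp, hc⟩ := card_cols_eq h hT
    rcases Nat.eq_zero_or_pos (T \ cols L T).card with h0 | h0
    · exact mul_le_per_of_no_private h hT ht h0 (hrow r (by simp))
    have hne := per_cols_ne_zero h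
    have hrow' : ∀ s ∈ L, k ≤ ∑ y ∈ cols L T, s y := by
      intro s hs
      refine (hrow s (by simp [hs])).trans (le_of_eq (Finset.sum_subset (cols_subset L T) ?_).symm)
      intro y hy hy'
      by_contra h'
      exact hy' (mem_cols.2 ⟨hy, fun h0 => h' (col_eq_zero_iff.1 h0 s hs)⟩)
    set p := (T \ cols L T).card with hpdef
    -- Write `t'` for `t + 1 - p`. The weaker bound `k + t'` also covers the case of two remaining
    -- rows and is all that is needed.
    have h1 : k + (t + 1 - p) ≤ per L (cols L T) := by
      rcases Nat.lt_or_ge L.length 3 with h3 | h3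
      · obtain _ | ⟨a, _ | ⟨b, _ | ⟨c, L⟩⟩⟩ := L
        · simp at hL
        · simp at hL
        · refine add_le_per_pair hne hc hk (hrow' a (by simp)) (hrow' b (by simp)) fun y hy => ?_
          simpa using one_le_col_of_mem_cols y hy
        · simp only [List.length_cons] at h3
          omega
      · refine (add_le_mul_succ _ hk).trans
          (ih L.length (by simp at hn; omega) hne h3 hc hrow' one_le_col_of_mem_cols rfl)
    -- Deleting one more column lowers the excess to `t' - 1`, hence `t'` here.
    have h2 : ∀ y ∈ cols L T, t + 1 - p ≤ per L ((cols L T).erase y) := by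
      intro y hy
      have := card_lt_per_add_length (L := L) (T := (cols L T).erase y)
        (by rw [per_erase_cols]; exact per_erase_ne_zero h ht y)
        (fun z hz => one_le_col_of_mem_cols z (Finset.mem_of_mem_erase hz))
      rw [Finset.card_erase_of_mem hy] at this
      omega
    have h3 : (∑ y ∈ cols L T, r y) * (t + 1 - p) ≤
        ∑ y ∈ cols L T, r y * per L ((cols L T).erase y) := by
      rw [Finset.sum_mul]
      exact Finset.sum_le_sum fun y hy => Nat.mul_le_mul_left _ (h2 y hy)
    have h4 := card_sdiff_cols_le hcol
    have h5 := hrow r (by simp)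
    rw [← Finset.sum_sdiff (cols_subset L T)] at h5
    rw [per_cons_eq]
    have h6 := Nat.mul_le_mul_left (∑ y ∈ T \ cols L T, r y) h1
    obtain ⟨t', ht'⟩ := Nat.exists_eq_add_of_le hp
    have h7 : t + 1 - p = t' := by omega
    rw [h7] at h3 h6
    rw [ht']
    rw [← hpdef, one_mul] at h4
    -- If `P` and `R` are the sums of `r` over its private and its other columns, then `P (k + t') +
    -- R t' = P k + (P + R) t' ≥ p k + k t' = k (t + 1)`.
    nlinarith [Nat.mul_le_mul_right t' h5, Nat.mul_le_mul_right k h4]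

lemma add_le_per {L : List (Y → ℕ)} {T : Finset Y} {k t : ℕ} (h : per L T ≠ 0)
    (hL : 2 ≤ L.length) (hT : T.card = L.length + t) (hk : 1 ≤ k)
    (hrow : ∀ r ∈ L, k ≤ ∑ y ∈ T, r y) (hcol : ∀ y ∈ T, 1 ≤ col L y) : k + t ≤ per L T := by
  rcases Nat.lt_or_ge L.length 3 with h3 | h3
  · obtain ⟨a, b, rfl⟩ := List.length_eq_two.1 (show L.length = 2 by omega)
    exact add_le_per_pair h hT hk (hrow a (by simp)) (hrow b (by simp))
      fun y hy => by simpa using hcol y hy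
  · exact (add_le_mul_succ _ hk).trans (mul_succ_le_per h h3 hT hrow hcol)

/-- Twice the permanent of two rows, as a sum over the columns. -/
lemma two_mul_per_pair (a b : Y → ℕ) (T : Finset Y) :
    2 * per [a, b] T =
      ∑ y ∈ T, (a y * ∑ z ∈ T.erase y, b z + b y * ∑ z ∈ T.erase y, a z) := by
  rw [Finset.sum_add_distrib, two_mul]
  nth_rewrite 2 [per_swap]
  simp only [per_cons _ [_], per_single]

lemma per_pair_eq_erase_add (a b : Y → ℕ) {T : Finset Y} {y : Y} (hy : y ∈ T) :
    per [a, b] T = per [a, b] (T.erase y) +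
      (a y * ∑ z ∈ T.erase y, b z + b y * ∑ z ∈ T.erase y, a z) := by
  have h1 := per_pair_add a b T
  have h2 := per_pair_add a b (T.erase y)
  rw [← Finset.add_sum_erase T _ hy, ← Finset.add_sum_erase T a hy,
    ← Finset.add_sum_erase T b hy] at h1
  nlinarith

/-- With `u` and `v` the sums of `a` and `b` outside `y`, the difference is `(a y - 1) * (v - 1) +
(b y - 1) * (u - 1)`. -/
lemma sum_add_sum_le_of_shared {a b : Y → ℕ} {T : Finset Y} {y : Y} (hy : y ∈ shared a b T)
    (ha : ∑ z ∈ T.erase y, a z ≠ 0) (hb : ∑ z ∈ T.erase y, b z ≠ 0) :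
    ∑ z ∈ T, a z + ∑ z ∈ T, b z ≤
      a y * ∑ z ∈ T.erase y, b z + b y * ∑ z ∈ T.erase y, a z + 2 := by
  simp only [shared, Finset.mem_filter] at hy
  rw [← Finset.add_sum_erase T a hy.1, ← Finset.add_sum_erase T b hy.1]
  generalize ∑ z ∈ T.erase y, a z = u at *
  generalize ∑ z ∈ T.erase y, b z = v at *
  obtain ⟨u, rfl⟩ := Nat.exists_eq_succ_of_ne_zero ha
  obtain ⟨v, rfl⟩ := Nat.exists_eq_succ_of_ne_zero hb
  obtain ⟨i, hi⟩ := Nat.exists_eq_succ_of_ne_zero hy.2.1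
  obtain ⟨j, hj⟩ := Nat.exists_eq_succ_of_ne_zero hy.2.2
  rw [hi, hj]
  simp only [Nat.succ_eq_add_one]
  nlinarith [Nat.zero_le (i * v), Nat.zero_le (j * u)]

lemma sum_erase_ne_zero {r : Y → ℕ} {L : List (Y → ℕ)} {T : Finset Y}
    (h : per (r :: L) T ≠ 0) (ht : ¬ Tight (r :: L) T) (hL : L ≠ []) (y : Y) :
    ∑ z ∈ T.erase y, r z ≠ 0 := by
  obtain ⟨z, hz, hzy, hr⟩ := exists_ne_of_not_tight h ht hL y
  intro h0
  exact hr (Finset.sum_eq_zero_iff.1 h0 z (Finset.mem_erase.2 ⟨hzy, hz⟩))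

/-- Twice the permanent is spread over the `t + 2` columns. An unshared column contributes at least
`2 * k`. A shared one may fall short by 2, but only if there are fewer than `k` shared columns,
because both rows also have private columns; the total loss is thus at most `2 * k`, the share of
one column. -/
lemma mul_succ_le_per_pair {a b : Y → ℕ} {T : Finset Y} {k t : ℕ} (h : per [a, b] T ≠ 0)
    (hT : T.card = 2 + t) (ha : k ≤ ∑ y ∈ T, a y) (hb : k ≤ ∑ y ∈ T, b y)
    (hcol : ∀ y ∈ T, 2 ≤ a y + b y) : k * (t + 1) ≤ per [a, b] T := by
  have hcol' : ∀ y ∈ T, 2 ≤ col [a, b] y := fun y hy => by simpa using hcol y hy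
  by_cases ht : Tight [a, b] T
  · exact mul_le_per_of_tight h hT (by simp [ha, hb])
      (fun y hy => one_le_two.trans (hcol' y hy)) ht
  have ht' : ¬ Tight [b, a] T := fun h' => ht (h'.perm (List.Perm.swap _ _ _))
  have h' : per [b, a] T ≠ 0 := by rwa [per_swap]
  rcases Nat.eq_zero_or_pos (T \ cols [b] T).card with h0 | h0
  · exact mul_le_per_of_no_private h hT ht h0 ha
  rcases Nat.eq_zero_or_pos (T \ cols [a] T).card with h1 | h1
  · rw [per_swap]
    exact mul_le_per_of_no_private h' hT ht' h1 hb
  have hα := card_sdiff_cols_le hcol'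
  have hβ := card_sdiff_cols_le (r := b) (L := [a]) (T := T) (c := 2)
    (fun y hy => by have := hcol y hy; simp; omega)
  have hsa := sum_eq_private_add_shared a b T
  have hsb := sum_eq_private_add_shared b a T
  have hqa := card_shared_le a b T
  have hqb := card_shared_le b a T
  rw [shared_comm b a] at hsb hqb
  have key : ∀ y ∈ T, 2 * k ≤ (a y * ∑ z ∈ T.erase y, b z + b y * ∑ z ∈ T.erase y, a z) +
      if y ∈ shared a b T then 2 * min 1 (k - (shared a b T).card) else 0 := by
    intro y hy
    split_ifs with hys
    · have := sum_add_sum_le_of_shared hys (sum_erase_ne_zero h ht (by simp) y)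
        (sum_erase_ne_zero h' ht' (by simp) y)
      omega
    · have h2 := hcol y hy
      rw [← Finset.add_sum_erase T a hy] at ha
      rw [← Finset.add_sum_erase T b hy] at hb
      by_cases ha0 : a y = 0
      · rw [ha0] at ha h2 ⊢
        nlinarith
      · have hb0 : b y = 0 := by
          by_contra hb0
          exact hys (by simp [shared, hy, ha0, hb0])
        rw [hb0] at hb h2 ⊢
        nlinarith
  have hsum := Finset.sum_le_sum key
  rw [Finset.sum_add_distrib, ← two_mul_per_pair, Finset.sum_const, smul_eq_mul, hT,
    ← Finset.sum_filter, Finset.sum_const, smul_eq_mul] at hsum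
  have hf : T.filter (fun y => y ∈ shared a b T) = shared a b T := by
    ext y; simp [shared]
  rw [hf] at hsum
  have : (shared a b T).card * (2 * min 1 (k - (shared a b T).card)) ≤ 2 * k := by
    rcases Nat.lt_or_ge (shared a b T).card k with hlt | hge
    · have : min 1 (k - (shared a b T).card) = 1 := by omega
      rw [this]; omega
    · have : min 1 (k - (shared a b T).card) = 0 := by omega
      rw [this]; omega
  nlinarith

/-- With `u = 2 p₁ + q - 1` and `v = 2 p₂ + q - 1`, one gets `Φ ≥ u B + v A - u v - (q - 1)`. Here
`u + v = 2 (t + 1)`, so `u v ≤ (t + 1) ^ 2`, and `q - 1 ≤ t + 1`. -/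
lemma pair_arith {k t p₁ p₂ q A' B' α' β' s Φ : ℤ} (hq : 1 ≤ q) (hp₁ : 0 ≤ p₁) (hp₂ : 0 ≤ p₂)
    (hA' : 0 ≤ A') (hB' : 0 ≤ B') (hα' : 0 ≤ α') (hβ' : 0 ≤ β') (ht : t = p₁ + p₂ + q - 2)
    (ha : k ≤ 2 * p₁ + α' + (q + A')) (hb : k ≤ 2 * p₂ + β' + (q + B'))
    (hs : s + q ≤ q + A' + (q + B') + A' * B')
    (hper : Φ + s = (2 * p₁ + α' + (q + A')) * (2 * p₂ + β' + (q + B'))) :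
    (2 * k - t - 2) * (t + 1) ≤ Φ := by
  obtain ⟨A, hA⟩ : ∃ A : ℤ, A = 2 * p₁ + α' + (q + A') := ⟨_, rfl⟩
  obtain ⟨B, hB⟩ : ∃ B : ℤ, B = 2 * p₂ + β' + (q + B') := ⟨_, rfl⟩
  obtain ⟨u, hu⟩ : ∃ u : ℤ, u = 2 * p₁ + q - 1 := ⟨_, rfl⟩
  obtain ⟨v, hv⟩ : ∃ v : ℤ, v = 2 * p₂ + q - 1 := ⟨_, rfl⟩
  rw [← hA, ← hB] at hper
  rw [← hA] at ha
  rw [← hB] at hb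
  have h1 : (A' + 1) * (B' + 1) ≤ (A - u) * (B - v) :=
    mul_le_mul (by linarith) (by linarith) (by linarith) (by linarith)
  have h2 := mul_le_mul_of_nonneg_left hb (show 0 ≤ u by linarith)
  have h3 := mul_le_mul_of_nonneg_left ha (show 0 ≤ v by linarith)
  have h4 : u + v = 2 * (t + 1) := by rw [hu, hv, ht]; ring
  have h5 : u * v ≤ (t + 1) ^ 2 := by nlinarith [mul_self_nonneg (u - v)]
  have h6 : u * k + v * k = 2 * (t + 1) * k := by rw [← h4]; ring
  have h7 : (A - u) * (B - v) = A * B - u * B - v * A + u * v := by ring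
  have h8 : (A' + 1) * (B' + 1) = A' * B' + A' + B' + 1 := by ring
  have h9 : (2 * k - t - 2) * (t + 1) = 2 * (t + 1) * k - (t + 1) ^ 2 - (t + 1) := by ring
  linarith

lemma two_mul_sub_mul_le_per_pair {a b : Y → ℕ} {T : Finset Y} {k t : ℕ}
    (hT : T.card = 2 + t) (ha : k ≤ ∑ y ∈ T, a y) (hb : k ≤ ∑ y ∈ T, b y)
    (hcol : ∀ y ∈ T, 2 ≤ a y + b y) :
    (2 * (k : ℤ) - t - 2) * (t + 1) ≤ per [a, b] T := by
  have hα := card_sdiff_cols_le (r := a) (L := [b]) (T := T) (c := 2)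
    (fun y hy => by have := hcol y hy; simp; omega)
  have hβ := card_sdiff_cols_le (r := b) (L := [a]) (T := T) (c := 2)
    (fun y hy => by have := hcol y hy; simp; omega)
  have hc := card_eq_private_add_shared fun y hy => one_le_two.trans (hcol y hy)
  have hsa := sum_eq_private_add_shared a b T
  have hsb := sum_eq_private_add_shared b a T
  have hqa := card_shared_le a b T
  have hqb := card_shared_le b a T
  have hs := sum_mul_add_card_le (a := a) (b := b) (Q := shared a b T)
    fun y hy => (Finset.mem_filter.1 hy).2
  rw [← sum_mul_eq_sum_shared] at hs
  have hper := per_pair_add a b T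
  rw [shared_comm b a] at hsb hqb
  -- Without shared columns the permanent is the product of the row sums, and `k ^ 2` suffices
  -- because `(k - t - 1) ^ 2 ≥ 0`.
  by_cases hq : (shared a b T).card = 0
  · have hQ := Finset.card_eq_zero.1 hq
    rw [sum_mul_eq_sum_shared, hQ, Finset.sum_empty, add_zero] at hper
    have h1 : (k * k : ℕ) ≤ per [a, b] T := by
      rw [hper]; exact Nat.mul_le_mul ha hb
    have h2 : ((k * k : ℕ) : ℤ) ≤ per [a, b] T := by exact_mod_cast h1
    refine le_trans ?_ h2
    push_cast
    by_cases hkt : 2 * (k : ℤ) - t - 2 ≤ 0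
    · nlinarith [mul_self_nonneg (k : ℤ)]
    · nlinarith [mul_self_nonneg ((k : ℤ) - t - 1)]
  generalize ∑ y ∈ T \ cols [b] T, a y = α at *
  generalize ∑ y ∈ T \ cols [a] T, b y = β at *
  generalize ∑ y ∈ shared a b T, a y = A at *
  generalize ∑ y ∈ shared a b T, b y = B at *
  generalize (shared a b T).card = q at *
  generalize (T \ cols [b] T).card = p₁ at *
  generalize (T \ cols [a] T).card = p₂ at *
  generalize ∑ y ∈ T, a y * b y = s at *
  generalize per [a, b] T = Φ at *
  rw [hsa] at hper ha
  rw [hsb] at hper hb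
  obtain ⟨A', rfl⟩ := Nat.exists_eq_add_of_le hqa
  obtain ⟨B', rfl⟩ := Nat.exists_eq_add_of_le hqb
  obtain ⟨α', rfl⟩ := Nat.exists_eq_add_of_le hα
  obtain ⟨β', rfl⟩ := Nat.exists_eq_add_of_le hβ
  simp only [Nat.add_sub_cancel_left] at hs
  have ht : (t : ℤ) = p₁ + p₂ + q - 2 := by omega
  zify at *
  exact pair_arith (by omega) (by positivity) (by positivity) (by positivity) (by positivity)
    (by positivity) (by positivity) ht ha hb hs hper

end Pairs

/-! ### Three rows with column sums at least two. -/

section Triples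

variable {Y : Type*}

lemma sum_cols {L : List (Y → ℕ)} {r : Y → ℕ} (hr : r ∈ L) (T : Finset Y) :
    ∑ y ∈ cols L T, r y = ∑ y ∈ T, r y := by
  refine Finset.sum_subset (cols_subset L T) fun y hy hy' => ?_
  by_contra h'
  exact hy' (mem_cols.2 ⟨hy, fun h0 => h' (col_eq_zero_iff.1 h0 r hr)⟩)

/-- Each column meets at least two of the three rows, and each row meets at least two columns. -/
structure Spread (a b c : Y → ℕ) (T : Finset Y) : Prop where
  col : ∀ y ∈ T, (a y ≠ 0 ∨ b y ≠ 0) ∧ (b y ≠ 0 ∨ c y ≠ 0) ∧ (c y ≠ 0 ∨ a y ≠ 0)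
  fst : ∀ y, ∃ z ∈ T, z ≠ y ∧ a z ≠ 0
  snd : ∀ y, ∃ z ∈ T, z ≠ y ∧ b z ≠ 0
  trd : ∀ y, ∃ z ∈ T, z ≠ y ∧ c z ≠ 0

lemma Spread.rotate {a b c : Y → ℕ} {T : Finset Y} (h : Spread a b c T) : Spread b c a T :=
  ⟨fun y hy => ⟨(h.col y hy).2.1, (h.col y hy).2.2, (h.col y hy).1⟩, h.snd, h.trd, h.fst⟩

variable [DecidableEq Y]

lemma sum_erase_cols_ne_zero {L : List (Y → ℕ)} {T : Finset Y} {s : Y → ℕ} (hs : s ∈ L)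
    {L' : List (Y → ℕ)} (hL' : L' ≠ []) (h : per (s :: L') T ≠ 0) (ht : ¬ Tight (s :: L') T)
    (y : Y) : ∑ z ∈ (cols L T).erase y, s z ≠ 0 := by
  obtain ⟨z, hz, hzy, hsz⟩ := exists_ne_of_not_tight h ht hL' y
  intro h0
  refine hsz (Finset.sum_eq_zero_iff.1 h0 z (Finset.mem_erase.2 ⟨hzy, mem_cols.2 ⟨hz, ?_⟩⟩))
  exact fun h0 => hsz (col_eq_zero_iff.1 h0 s hs)

/-- This bounds the share of a column that `b` meets and `c` does not. If `b y = 1`, then `x y ≥ 1`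
and the minor is at least `(k - 1) + t`; otherwise the term of `b` alone is at least `2 * k`. -/
lemma two_mul_add_min_le {x b c : Y → ℕ} {Z : Finset Y} {k t : ℕ} {y : Y} (hy : y ∈ Z)
    (hZ : Z.card = 2 + (t + 1)) (hk : 2 ≤ k) (hb : k ≤ ∑ z ∈ Z, b z) (hc : k ≤ ∑ z ∈ Z, c z)
    (hcol : 2 ≤ x y + b y + c y) (hcol' : ∀ z ∈ Z, 1 ≤ b z + c z)
    (hne : per [b, c] (Z.erase y) ≠ 0) (hcy : c y = 0) :
    2 * k + min (t + 1) 2 ≤ (b y * ∑ z ∈ Z.erase y, c z + c y * ∑ z ∈ Z.erase y, b z) +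
      x y * per [b, c] (Z.erase y) + 2 := by
  have h1 := Finset.add_sum_erase Z b hy
  have h2 := Finset.add_sum_erase Z c hy
  rw [hcy, zero_add] at h2
  rw [hcy, zero_mul, add_zero, h2]
  have h3 := hcol' y hy
  rw [hcy] at h3 hcol
  by_cases hb2 : 2 ≤ b y
  · have : 2 * k ≤ b y * ∑ z ∈ Z, c z := Nat.mul_le_mul hb2 hc
    omega
  · have hb1 : b y = 1 := by omega
    have h4 : (k - 1) + t ≤ per [b, c] (Z.erase y) := by
      refine add_le_per_pair hne ?_ (by omega) (by omega) (by omega)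
        fun z hz => hcol' z (Finset.mem_of_mem_erase hz)
      rw [Finset.card_erase_of_mem hy]; omega
    have h5 : per [b, c] (Z.erase y) ≤ x y * per [b, c] (Z.erase y) :=
      Nat.le_mul_of_pos_left _ (by omega)
    rw [hb1, one_mul]
    omega

/-- The row `x` has a private column. Twice the permanent of `b` and `c` is spread over the
remaining columns and added to the terms of `x` there. -/
lemma two_mul_le_per_of_private {x b c : Y → ℕ} {T : Finset Y} {k t : ℕ}
    (h : per [x, b, c] T ≠ 0) (ht : ¬ Tight [x, b, c] T) (hT : T.card = 3 + t) (hk : 3 ≤ k)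
    (hb : k ≤ ∑ y ∈ T, b y) (hc : k ≤ ∑ y ∈ T, c y) (hcol : ∀ y ∈ T, 2 ≤ x y + b y + c y)
    (hp : (T \ cols [b, c] T).card ≠ 0) : 2 * k * (t + 1) ≤ per [x, b, c] T := by
  obtain ⟨hp1, hZ⟩ := card_cols_eq h hT
  have hα := card_sdiff_cols_le (r := x) (L := [b, c]) (T := T) (c := 2)
    (fun y hy => by have := hcol y hy; simp; omega)
  have hne := per_cols_ne_zero h
  have hbZ : k ≤ ∑ y ∈ cols [b, c] T, b y := by rwa [sum_cols (by simp)]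
  have hcZ : k ≤ ∑ y ∈ cols [b, c] T, c y := by rwa [sum_cols (by simp)]
  have herase : ∀ y, per [b, c] ((cols [b, c] T).erase y) ≠ 0 := fun y => by
    rw [per_erase_cols]; exact per_erase_ne_zero h ht y
  have hsub := cols_subset [b, c] T
  have hb0 : ∀ y, ∑ z ∈ (cols [b, c] T).erase y, b z ≠ 0 := by
    have hperm : [x, b, c].Perm [b, x, c] := List.Perm.swap _ _ _
    refine sum_erase_cols_ne_zero (by simp) (L' := [x, c]) (by simp) ?_ ?_
    · rwa [← per_perm hperm]
    · exact fun h' => ht (h'.perm hperm.symm)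
  have hc0 : ∀ y, ∑ z ∈ (cols [b, c] T).erase y, c z ≠ 0 := by
    have hperm : [x, b, c].Perm [c, x, b] :=
      (List.perm_append_comm (l₁ := [x, b]) (l₂ := [c]))
    refine sum_erase_cols_ne_zero (by simp) (L' := [x, b]) (by simp) ?_ ?_
    · rwa [← per_perm hperm]
    · exact fun h' => ht (h'.perm hperm.symm)
  have hcolZ : ∀ y ∈ cols [b, c] T, 1 ≤ b y + c y := fun y hy => by
    simpa using one_le_col_of_mem_cols y hy
  rw [per_cons_eq]
  generalize (T \ cols [b, c] T).card = p at *
  generalize ∑ y ∈ T \ cols [b, c] T, x y = p' at *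
  generalize cols [b, c] T = Z at *
  obtain ⟨t', ht'⟩ := Nat.exists_eq_add_of_le hp1
  rw [show t + 1 - p = t' by omega] at hZ
  simp only [List.length_cons, List.length_nil, zero_add, Nat.reduceAdd] at hZ
  have hΦ : k ≤ per [b, c] Z :=
    (Nat.le_add_right k t').trans (add_le_per_pair hne hZ (by omega) hbZ hcZ hcolZ)
  -- The summand `2 * per [b, c] Z` accounts for two units of `x` in one private column; every
  -- further private column adds another `2 * k`.
  have hmain : 2 * k * (t' + 1) ≤
      2 * per [b, c] Z + ∑ y ∈ Z, x y * per [b, c] (Z.erase y) := by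
    rcases t' with _ | t'
    · omega
    set q := (shared b c Z).card with hq
    have hqb := (card_shared_le b c Z).trans
      (Finset.sum_le_sum_of_subset (Finset.filter_subset _ _))
    have hqc := (card_shared_le c b Z).trans
      (Finset.sum_le_sum_of_subset (Finset.filter_subset _ _))
    rw [shared_comm c b] at hqc
    rw [← hq] at hqb hqc
    rw [two_mul_per_pair, ← Finset.sum_add_distrib]
    have hcase : ∀ y ∈ Z, y ∉ shared b c Z → 2 * k + min (t' + 1) 2 ≤
        (b y * ∑ z ∈ Z.erase y, c z + c y * ∑ z ∈ Z.erase y, b z) +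
          x y * per [b, c] (Z.erase y) + 2 := by
      intro y hy hys
      by_cases hcy : c y = 0
      · exact two_mul_add_min_le hy hZ (by omega) hbZ hcZ (hcol y (hsub hy)) hcolZ (herase y) hcy
      · have hby : b y = 0 := by
          by_contra hby
          exact hys (by simp [shared, hy, hby, hcy])
        rw [per_swap, add_comm (b y * _)]
        refine two_mul_add_min_le hy hZ (by omega) hcZ hbZ ?_ ?_ ?_ hby
        · have := hcol y (hsub hy); omega
        · intro z hz; have := hcolZ z hz; omega
        · rw [per_swap]; exact herase y
    have hcase' : ∀ y ∈ shared b c Z, 2 * max k q ≤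
        (b y * ∑ z ∈ Z.erase y, c z + c y * ∑ z ∈ Z.erase y, b z) +
          x y * per [b, c] (Z.erase y) + 2 := by
      intro y hy
      have := sum_add_sum_le_of_shared hy (hb0 y) (hc0 y)
      omega
    generalize hg : (fun y => (b y * ∑ z ∈ Z.erase y, c z + c y * ∑ z ∈ Z.erase y, b z) +
          x y * per [b, c] (Z.erase y)) = g
    have hg' : ∀ y, (b y * ∑ z ∈ Z.erase y, c z + c y * ∑ z ∈ Z.erase y, b z) +
          x y * per [b, c] (Z.erase y) = g y := fun y => by rw [← hg]
    simp only [hg'] at hcase hcase' ⊢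
    rcases t' with _ | t'
    -- Excess 1: there are three columns, and `3 * (2 * k - 2) ≥ 4 * k` because `k ≥ 3`.
    · have : Z.card • (2 * k - 2) ≤ ∑ y ∈ Z, g y := by
        refine Finset.card_nsmul_le_sum _ _ _ fun y hy => ?_
        by_cases hys : y ∈ shared b c Z
        · have := hcase' y hys; omega
        · have := hcase y hy hys; omega
      rw [hZ, smul_eq_mul] at this
      exact le_trans (by omega) this
    · have hall : ∀ y ∈ Z, 2 * k ≤ g y +
          if y ∈ shared b c Z then 2 * min 1 (k + 1 - q) else 0 := by
        intro y hy
        split_ifs with hys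
        · have := hcase' y hys; omega
        · have := hcase y hy hys; omega
      have hsum := Finset.sum_le_sum hall
      have hf : Z.filter (fun y => y ∈ shared b c Z) = shared b c Z := by
        ext y; simp [shared]
      rw [Finset.sum_add_distrib, Finset.sum_const, smul_eq_mul, hZ,
        ← Finset.sum_filter, Finset.sum_const, smul_eq_mul, hf, ← hq] at hsum
      -- Shared columns fall short only if `q ≤ k`, so the total loss is at most the share of one
      -- column.
      have : q * (2 * min 1 (k + 1 - q)) ≤ 2 * k := by
        rcases Nat.lt_or_ge k q with hlt | hge
        · have : min 1 (k + 1 - q) = 0 := by omega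
          rw [this]; omega
        · have : min 1 (k + 1 - q) = 1 := by omega
          rw [this]; omega
      nlinarith
  have h1 : 2 * p * per [b, c] Z ≤ p' * per [b, c] Z := Nat.mul_le_mul_right _ hα
  obtain ⟨p₀, rfl⟩ := Nat.exists_eq_succ_of_ne_zero hp
  rw [ht']
  simp only [Nat.succ_eq_add_one] at *
  nlinarith [Nat.mul_le_mul_left p₀ hΦ]

lemma per_rotate (a b c : Y → ℕ) (T : Finset Y) : per [b, c, a] T = per [a, b, c] T :=
  per_perm (List.perm_append_comm (l₁ := [b, c]) (l₂ := [a])) T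

lemma per_pair_ne_zero {b c : Y → ℕ} {S : Finset Y} (hS : 2 ≤ S.card) (hb : ∃ z ∈ S, b z ≠ 0)
    (hc : ∃ z ∈ S, c z ≠ 0) (h : ∀ z ∈ S, b z ≠ 0 ∨ c z ≠ 0) : per [b, c] S ≠ 0 := by
  have key : ∀ v ∈ S, ∀ w ∈ S, v ≠ w → b v ≠ 0 → c w ≠ 0 → per [b, c] S ≠ 0 := by
    intro v hv w hw hvw hbv hcw h0
    rw [per_cons, Finset.sum_eq_zero_iff] at h0
    rcases Nat.mul_eq_zero.1 (h0 v hv) with h1 | h1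
    · exact hbv h1
    · rw [per_single, Finset.sum_eq_zero_iff] at h1
      exact hcw (h1 w (Finset.mem_erase.2 ⟨hvw.symm, hw⟩))
  obtain ⟨v, hv, hbv⟩ := hb
  obtain ⟨w, hw, hcw⟩ := hc
  by_cases hvw : v = w
  · subst hvw
    obtain ⟨u, hu, huv⟩ := Finset.exists_mem_ne hS v
    rcases h u hu with h1 | h1
    · exact key u hu v hv huv h1 hcw
    · exact key v hv u hu huv.symm hbv h1
  · exact key v hv w hw hvw hbv hcw

lemma Spread.per_erase_ne_zero {a b c : Y → ℕ} {T : Finset Y} (h : Spread a b c T)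
    (hT : 3 ≤ T.card) {y : Y} (hy : y ∈ T) : per [b, c] (T.erase y) ≠ 0 := by
  refine per_pair_ne_zero (by rw [Finset.card_erase_of_mem hy]; omega) ?_ ?_ ?_
  · obtain ⟨z, hz, hzy, hne⟩ := h.snd y
    exact ⟨z, Finset.mem_erase.2 ⟨hzy, hz⟩, hne⟩
  · obtain ⟨z, hz, hzy, hne⟩ := h.trd y
    exact ⟨z, Finset.mem_erase.2 ⟨hzy, hz⟩, hne⟩
  · exact fun z hz => (h.col z (Finset.mem_of_mem_erase hz)).2.1

/-- The row `a` with one unit removed in the column `y`. -/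
def dec (a : Y → ℕ) (y : Y) : Y → ℕ := Function.update a y (a y - 1)

lemma sum_dec_add_one {a : Y → ℕ} {T : Finset Y} {y : Y} (hy : y ∈ T) (ha : a y ≠ 0) :
    ∑ z ∈ T, dec a y z + 1 = ∑ z ∈ T, a z := by
  rw [← Finset.add_sum_erase T a hy, ← Finset.add_sum_erase T (dec a y) hy]
  have : ∑ z ∈ T.erase y, dec a y z = ∑ z ∈ T.erase y, a z :=
    Finset.sum_congr rfl fun z hz => by simp [dec, Finset.ne_of_mem_erase hz]
  rw [this]
  simp only [dec, Function.update_self]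
  omega

lemma per_dec_add {a : Y → ℕ} {L : List (Y → ℕ)} {T : Finset Y} {y : Y} (hy : y ∈ T)
    (ha : a y ≠ 0) : per (dec a y :: L) T + per L (T.erase y) = per (a :: L) T := by
  rw [per_cons, per_cons, ← Finset.add_sum_erase T _ hy,
    ← Finset.add_sum_erase T (fun z => a z * per L (T.erase z)) hy]
  have : ∑ z ∈ T.erase y, dec a y z * per L (T.erase z) =
      ∑ z ∈ T.erase y, a z * per L (T.erase z) :=
    Finset.sum_congr rfl fun z hz => by simp [dec, Finset.ne_of_mem_erase hz]
  rw [this]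
  simp only [dec, Function.update_self]
  obtain ⟨n, hn⟩ := Nat.exists_eq_succ_of_ne_zero ha
  rw [hn]
  simp only [Nat.succ_eq_add_one, Nat.add_sub_cancel]
  ring

lemma Spread.dec_of_two_le {a b c : Y → ℕ} {T : Finset Y} (h : Spread a b c T) {y : Y}
    (ha : 2 ≤ a y) : Spread (dec a y) b c T := by
  have hd : ∀ z, dec a y z ≠ 0 ↔ a z ≠ 0 := by
    intro z
    by_cases hz : z = y
    · subst hz; simp only [dec, Function.update_self]; omega
    · simp [dec, hz]
  refine ⟨fun z hz => ?_, fun z => ?_, h.snd, h.trd⟩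
  · rw [hd]; exact h.col z hz
  · simp only [hd]; exact h.fst z

lemma Spread.dec_of_row {a b c : Y → ℕ} {T : Finset Y} (h : Spread a b c T) {y : Y}
    (hb : b y ≠ 0) (hc : c y ≠ 0) (hrow : ∀ w, ∃ z ∈ T, z ≠ w ∧ z ≠ y ∧ a z ≠ 0) :
    Spread (dec a y) b c T := by
  refine ⟨fun z hz => ?_, fun w => ?_, h.snd, h.trd⟩
  · by_cases hzy : z = y
    · subst hzy
      exact ⟨Or.inr hb, Or.inl hb, Or.inl hc⟩
    · have : dec a y z = a z := by simp [dec, hzy]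
      rw [this]; exact h.col z hz
  · obtain ⟨z, hz, hzw, hzy, hne⟩ := hrow w
    exact ⟨z, hz, hzw, by simpa [dec, hzy] using hne⟩

/-- The column `y` still meets `b` and `c`, so only the row `a` can violate the spread condition
after the removal. -/
lemma sum_le_two_of_not_spread_dec {a b c : Y → ℕ} {T : Finset Y} (h : Spread a b c T) {y : Y}
    (hb : b y ≠ 0) (hc : c y ≠ 0) (h1 : ∀ z ∈ T, a z ≤ 1) (hn : ¬ Spread (dec a y) b c T) :
    ∑ z ∈ T, a z ≤ 2 := by
  by_contra hlt
  refine hn (h.dec_of_row hb hc fun w => ?_)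
  by_contra hno
  push Not at hno
  apply hlt
  calc ∑ z ∈ T, a z ≤ ∑ z ∈ T, ((if z = w then 1 else 0) + if z = y then 1 else 0) := by
        refine Finset.sum_le_sum fun z hz => ?_
        by_cases hzw : z = w
        · rw [if_pos hzw]; have := h1 z hz; omega
        · by_cases hzy : z = y
          · rw [if_pos hzy]; have := h1 z hz; omega
          · rw [hno z hz hzw hzy]; omega
    _ ≤ 2 := by
        rw [Finset.sum_add_distrib, Finset.sum_ite_eq', Finset.sum_ite_eq']
        split_ifs <;> omega

/-- If a variable `u` is at least 2, then `u (M - u) ≥ 2 (M - 2)`, and the remaining terms are `v w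
(M - 2 - u) ≥ 0`. Otherwise all three equal 1, with equality. -/
lemma triple_arith {M x y z : ℤ} (hM : 3 ≤ M) (hx : 0 ≤ x) (hy : 0 ≤ y) (hz : 0 ≤ z)
    (hx' : x ≤ M - 2) (hy' : y ≤ M - 2) (hz' : z ≤ M - 2) (h : x + y + z = M) :
    2 * (M - 2) ^ 2 ≤ (M - 2) * (x * y + y * z + z * x) - x * y * z := by
  have key : ∀ u v w : ℤ, 2 ≤ u → 0 ≤ v → 0 ≤ w → u ≤ M - 2 → u + v + w = M →
      2 * (M - 2) ^ 2 ≤ (M - 2) * (u * v + v * w + w * u) - u * v * w := by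
    intro u v w hu hv hw hu' hs
    have h1 : 2 * (M - 2) ≤ u * (v + w) := by
      have : v + w = M - u := by linarith
      rw [this]
      nlinarith [mul_nonneg (show 0 ≤ u - 2 by linarith) (show 0 ≤ M - u - 2 by linarith)]
    have h2 := mul_le_mul_of_nonneg_left h1 (show 0 ≤ M - 2 by linarith)
    have h3 := mul_nonneg (mul_nonneg hv hw) (show 0 ≤ M - 2 - u by linarith)
    nlinarith
  by_cases h1 : 2 ≤ x
  · exact key x y z h1 hy hz hx' h
  by_cases h2 : 2 ≤ y
  · have := key y z x h2 hz hx hy' (by linarith)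
    linarith [mul_comm x (y * z), mul_assoc x y z, mul_comm (y * z) x]
  by_cases h3 : 2 ≤ z
  · have := key z x y h3 hx hy hz' (by linarith)
    nlinarith
  have hx1 : x = 1 := by omega
  have hy1 : y = 1 := by omega
  have hz1 : z = 1 := by omega
  have hM3 : M = 3 := by omega
  subst hx1 hy1 hz1 hM3
  norm_num

lemma per_triple_of_simple {a b c : Y → ℕ} {T : Finset Y} (h0 : ∀ y ∈ T, a y * b y * c y = 0) :
    per [a, b, c] T + (∑ y ∈ T, c y) * ∑ y ∈ T, a y * b y +
      (∑ y ∈ T, b y) * ∑ y ∈ T, a y * c y = (∑ y ∈ T, a y) * per [b, c] T := by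
  rw [per_cons, Finset.mul_sum, Finset.mul_sum, ← Finset.sum_add_distrib,
    ← Finset.sum_add_distrib, Finset.sum_mul]
  refine Finset.sum_congr rfl fun y hy => ?_
  rw [per_pair_eq_erase_add b c hy, ← Finset.add_sum_erase T c hy, ← Finset.add_sum_erase T b hy]
  linear_combination 2 * h0 y hy

/-- Each column has exactly two ones. If `x`, `y`, `z` count the columns of the three types and `M =
t + 3`, then all entries sum to `2 M` and the permanent is `(M - 2)(xy + yz + zx) - xyz`. -/
lemma Spread.mul_le_per_of_simple {a b c : Y → ℕ} {T : Finset Y} {t : ℕ} (h : Spread a b c T)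
    (hT : T.card = 3 + t) (ha : ∀ y ∈ T, a y ≤ 1) (hb : ∀ y ∈ T, b y ≤ 1) (hc : ∀ y ∈ T, c y ≤ 1)
    (h2 : ∀ y ∈ T, a y = 0 ∨ b y = 0 ∨ c y = 0) :
    (∑ y ∈ T, a y + ∑ y ∈ T, b y + ∑ y ∈ T, c y) * (t + 1) ≤ per [a, b, c] T + 4 * (t + 1) := by
  have key : ∀ u v w : Y → ℕ, Spread u v w T → (∀ y ∈ T, u y ≤ 1) → (∀ y ∈ T, v y ≤ 1) →
      (∀ y ∈ T, w y ≤ 1) → (∀ y ∈ T, u y = 0 ∨ v y = 0 ∨ w y = 0) →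
      ∑ y ∈ T, u y * v y + ∑ y ∈ T, w y = T.card := by
    intro u v w hs hu hv hw h0
    rw [Finset.card_eq_sum_ones, ← Finset.sum_add_distrib]
    refine Finset.sum_congr rfl fun y hy => ?_
    have h1 := hs.col y hy
    have h2 := hu y hy
    have h3 := hv y hy
    have h4 := hw y hy
    have h5 := h0 y hy
    interval_cases u y <;> interval_cases v y <;> interval_cases w y <;> simp_all
  have hrow : ∀ u v w : Y → ℕ, Spread u v w T → 2 ≤ ∑ y ∈ T, u y := by
    intro u v w hs
    have hpos : 0 < T.card := by omega
    obtain ⟨y₀, _⟩ := Finset.card_pos.1 hpos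
    obtain ⟨y, hy, -, hu⟩ := hs.fst y₀
    obtain ⟨z, hz, hzy, hu'⟩ := hs.fst y
    rw [← Finset.add_sum_erase T u hy, ← Finset.add_sum_erase _ u (Finset.mem_erase.2 ⟨hzy, hz⟩)]
    omega
  have hab := key a b c h ha hb hc h2
  have hbc := key b c a h.rotate hb hc ha fun y hy => by have := h2 y hy; tauto
  have hca := key c a b h.rotate.rotate hc ha hb fun y hy => by have := h2 y hy; tauto
  have hA := hrow a b c h
  have hB := hrow b c a h.rotate
  have hC := hrow c a b h.rotate.rotate
  have htot : ∑ y ∈ T, a y + ∑ y ∈ T, b y + ∑ y ∈ T, c y = 2 * T.card := by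
    rw [← Finset.sum_add_distrib, ← Finset.sum_add_distrib, mul_comm, ← smul_eq_mul,
      ← Finset.sum_const]
    refine Finset.sum_congr rfl fun y hy => ?_
    have h1 := h.col y hy
    have h3 := ha y hy
    have h4 := hb y hy
    have h5 := hc y hy
    have h6 := h2 y hy
    omega
  have h3 := per_triple_of_simple (a := a) (b := b) (c := c) (T := T) fun y hy => by
    rcases h2 y hy with h | h | h <;> simp [h]
  have h4 := per_pair_add b c T
  have hac : ∑ y ∈ T, a y * c y = ∑ y ∈ T, c y * a y :=
    Finset.sum_congr rfl fun y _ => mul_comm _ _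
  rw [hac] at h3
  generalize ∑ y ∈ T, a y * b y = ab at *
  generalize ∑ y ∈ T, b y * c y = bc at *
  generalize ∑ y ∈ T, c y * a y = ca at *
  generalize ∑ y ∈ T, a y = A at *
  generalize ∑ y ∈ T, b y = B at *
  generalize ∑ y ∈ T, c y = C at *
  generalize per [a, b, c] T = Φ at *
  generalize per [b, c] T = Ψ at *
  rw [hT] at *
  zify at *
  have hkey := triple_arith (M := 3 + t) (x := bc) (y := ca) (z := ab) (by linarith)
    (by positivity) (by positivity) (by positivity) (by linarith) (by linarith) (by linarith)
    (by linarith)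
  have eA : (A : ℤ) = 3 + t - bc := by linarith
  have eB : (B : ℤ) = 3 + t - ca := by linarith
  have eC : (C : ℤ) = 3 + t - ab := by linarith
  have eab : (ab : ℤ) = 3 + t - bc - ca := by linarith
  have eΨ : (Ψ : ℤ) = B * C - bc := by linarith
  have eΦ : (Φ : ℤ) = A * Ψ - C * ab - B * ca := by linarith
  rw [htot, eΦ, eΨ, eA, eB, eC]
  rw [eab] at hkey ⊢
  nlinarith

/-- The permanent of a spread matrix with three rows and `t + 3` columns is at least
`(s - 4) (t + 1)`, where `s` is the sum of all entries. -/
lemma Spread.mul_le_per {a b c : Y → ℕ} {T : Finset Y} {t : ℕ} (h : Spread a b c T)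
    (hT : T.card = 3 + t) :
    (∑ y ∈ T, a y + ∑ y ∈ T, b y + ∑ y ∈ T, c y) * (t + 1) ≤ per [a, b, c] T + 4 * (t + 1) := by
  induction hN : ∑ y ∈ T, a y + ∑ y ∈ T, b y + ∑ y ∈ T, c y using Nat.strong_induction_on
    generalizing a b c with
  | _ N ih =>
    have step : ∀ u v w : Y → ℕ, Spread u v w T →
        ∑ y ∈ T, u y + ∑ y ∈ T, v y + ∑ y ∈ T, w y = N →
        (∃ y ∈ T, u y ≠ 0 ∧ Spread (dec u y) v w T) →
        N * (t + 1) ≤ per [u, v, w] T + 4 * (t + 1) := by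
      rintro u v w hs hN ⟨y, hy, hu, hd⟩
      have h1 := sum_dec_add_one hy hu
      have h2 := ih _ (by omega) hd rfl
      -- Removing the unit lowers the permanent by exactly this minor, so the induction gains `t +
      -- 1` per unit.
      have h3 : t + 1 ≤ per [v, w] (T.erase y) := by
        refine succ_le_per (hs.per_erase_ne_zero (by omega) hy) ?_ fun z hz => ?_
        · rw [Finset.card_erase_of_mem hy, hT]; simp only [List.length_cons, List.length_nil]; omega
        · have := (hs.col z (Finset.mem_of_mem_erase hz)).2.1
          simp; omega
      have h4 := per_dec_add (L := [v, w]) hy hu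
      obtain ⟨N, rfl⟩ : ∃ N', N = N' + 1 := ⟨N - 1, by omega⟩
      rw [show ∑ z ∈ T, dec u y z + ∑ y ∈ T, v y + ∑ y ∈ T, w y = N by omega] at h2
      nlinarith
    by_cases ha : ∃ y ∈ T, a y ≠ 0 ∧ Spread (dec a y) b c T
    · exact step a b c h hN ha
    by_cases hb : ∃ y ∈ T, b y ≠ 0 ∧ Spread (dec b y) c a T
    · have := step b c a h.rotate (by omega) hb
      rwa [per_rotate] at this
    by_cases hc : ∃ y ∈ T, c y ≠ 0 ∧ Spread (dec c y) a b T
    · have := step c a b h.rotate.rotate (by omega) hc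
      rwa [per_rotate, per_rotate] at this
    push Not at ha hb hc
    have hle : ∀ u v w : Y → ℕ, Spread u v w T →
        (∀ y ∈ T, u y ≠ 0 → ¬ Spread (dec u y) v w T) → ∀ y ∈ T, u y ≤ 1 := by
      intro u v w hs hu y hy
      by_contra hlt
      exact hu y hy (by omega) (hs.dec_of_two_le (by omega))
    have ha1 := hle a b c h ha
    have hb1 := hle b c a h.rotate hb
    have hc1 := hle c a b h.rotate.rotate hc
    rw [← hN]
    refine h.mul_le_per_of_simple hT ha1 hb1 hc1 fun y hy => ?_
    by_contra hno
    push Not at hno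
    obtain ⟨ha0, hb0, hc0⟩ := hno
    have h1 := sum_le_two_of_not_spread_dec h hb0 hc0 ha1 (ha y hy ha0)
    have h2 := sum_le_two_of_not_spread_dec h.rotate hc0 ha0 hb1 (hb y hy hb0)
    have h3 := sum_le_two_of_not_spread_dec h.rotate.rotate ha0 hb0 hc1 (hc y hy hc0)
    -- All columns have sum at least 2 and `y` has at least 3, so the total exceeds `2 * (t + 3) ≥
    -- 6`, against three row sums of at most 2.
    have h4 : ∑ _y ∈ T, 2 < ∑ y ∈ T, (a y + b y + c y) := by
      refine Finset.sum_lt_sum (fun z hz => ?_) ⟨y, hy, by omega⟩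
      have := h.col z hz
      omega
    rw [Finset.sum_const, smul_eq_mul, Finset.sum_add_distrib, Finset.sum_add_distrib] at h4
    omega

lemma Spread.eleven_le_per_of_col {a b c : Y → ℕ} {T : Finset Y} (h : Spread a b c T)
    (hT : T.card = 4) (ha : ∑ y ∈ T, a y = 3) (hb : ∑ y ∈ T, b y = 3) (hc : ∑ y ∈ T, c y = 3)
    {y : Y} (hy : y ∈ T) (hle : ∀ z ∈ T, z ≠ y → a z ≤ 1) (hb1 : b y ≤ 1) (hc1 : c y ≤ 1)
    (ha1 : a y = 2 ∨ a y = 1 ∧ b y = 1 ∧ c y = 1) : 11 ≤ per [a, b, c] T := by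
  have ha0 : a y ≠ 0 := by omega
  have hd : Spread (dec a y) b c T := by
    rcases ha1 with h2 | ⟨h1, h2, h3⟩
    · exact h.dec_of_two_le (by omega)
    · refine h.dec_of_row (by omega) (by omega) fun w => ?_
      by_contra hno
      push Not at hno
      have hlt : ∑ z ∈ T.erase y, a z ≤ ∑ z ∈ T.erase y, if z = w then 1 else 0 := by
        refine Finset.sum_le_sum fun z hz => ?_
        rw [Finset.mem_erase] at hz
        split_ifs with hzw
        · exact hle z hz.2 hz.1
        · rw [hno z hz.2 hzw hz.1]
      rw [Finset.sum_ite_eq'] at hlt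
      rw [← Finset.add_sum_erase T a hy] at ha
      split_ifs at hlt <;> omega
  have h1 := hd.mul_le_per (t := 1) hT
  have h2 := sum_dec_add_one hy ha0
  have h3 := per_dec_add (L := [b, c]) hy ha0
  -- The rows `b` and `c` lose at most one unit in `y`, so this minor is at least 3 and not just `t
  -- + 1 = 2`. With `(8 - 4) * 2` for the reduced matrix this makes 11.
  have h4 : 2 + 1 ≤ per [b, c] (T.erase y) := by
    rw [← Finset.add_sum_erase T _ hy] at hb hc
    refine add_le_per_pair (h.per_erase_ne_zero (by omega) hy) ?_ (by omega) (by omega) (by omega)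
      fun z hz => ?_
    · rw [Finset.card_erase_of_mem hy]; omega
    · have := (h.col z (Finset.mem_of_mem_erase hz)).2.1
      omega
  omega

/-- Nine units on four columns force one column of sum 3, with entries `2, 1, 0` or `1, 1, 1` in
some order, and three columns with entries `1, 1, 0`. A unit is removed from the heavy column, at
its entry 2 if there is one. -/
lemma Spread.eleven_le_per {a b c : Y → ℕ} {T : Finset Y} (h : Spread a b c T)
    (hT : T.card = 4) (ha : ∑ y ∈ T, a y = 3) (hb : ∑ y ∈ T, b y = 3) (hc : ∑ y ∈ T, c y = 3) :
    11 ≤ per [a, b, c] T := by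
  have hsum : ∑ y ∈ T, (a y + b y + c y) = 9 := by
    rw [Finset.sum_add_distrib, Finset.sum_add_distrib]; omega
  have h2 : ∀ y ∈ T, 2 ≤ a y + b y + c y := fun y hy => by have := h.col y hy; omega
  obtain ⟨y, hy, h3⟩ : ∃ y ∈ T, 2 < a y + b y + c y := by
    by_contra hno
    push Not at hno
    have := Finset.sum_le_card_nsmul T _ 2 hno
    rw [hT, hsum] at this
    simp at this
  rw [← Finset.add_sum_erase T _ hy] at hsum
  have hrest : ∀ z ∈ T, z ≠ y → a y + b y + c y = 3 ∧ a z + b z + c z = 2 := by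
    intro z hz hzy
    have hz' := Finset.mem_erase.2 ⟨hzy, hz⟩
    rw [← Finset.add_sum_erase _ _ hz'] at hsum
    have h4 := Finset.card_nsmul_le_sum ((T.erase y).erase z) (fun y => a y + b y + c y) 2
      fun w hw => h2 w (Finset.mem_of_mem_erase (Finset.mem_of_mem_erase hw))
    rw [Finset.card_erase_of_mem hz', Finset.card_erase_of_mem hy, hT] at h4
    have h5 := h2 z hz
    simp only [smul_eq_mul] at h4
    omega
  have hy3 : a y + b y + c y = 3 := by
    obtain ⟨z, hz, hzy, -⟩ := h.fst y
    exact (hrest z hz hzy).1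
  have hle : ∀ z ∈ T, z ≠ y → a z ≤ 1 ∧ b z ≤ 1 ∧ c z ≤ 1 := by
    intro z hz hzy
    have h1 := (hrest z hz hzy).2
    have h2 := h.col z hz
    omega
  have hcy := h.col y hy
  by_cases hb2 : b y = 2
  · rw [← per_rotate]
    exact h.rotate.eleven_le_per_of_col hT hb hc ha hy (fun z hz hzy => (hle z hz hzy).2.1)
      (by omega) (by omega) (by omega)
  by_cases hc2 : c y = 2
  · rw [← per_rotate, ← per_rotate]
    exact h.rotate.rotate.eleven_le_per_of_col hT hc ha hb hy
      (fun z hz hzy => (hle z hz hzy).2.2) (by omega) (by omega) (by omega)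
  exact h.eleven_le_per_of_col hT ha hb hc hy (fun z hz hzy => (hle z hz hzy).1)
    (by omega) (by omega) (by omega)

lemma two_mul_le_per_of_tight {L : List (Y → ℕ)} {T : Finset Y} {k t : ℕ} (h : per L T ≠ 0)
    (hT : T.card = L.length + t) (hrow : ∀ r ∈ L, k ≤ ∑ y ∈ T, r y)
    (hcol : ∀ y ∈ T, 2 ≤ col L y) (ht : Tight L T) : 2 * k * (t + 1) ≤ per L T := by
  obtain ⟨L₁, L₂, T₁, h₁, h₂, hp, hf, hc₁, hc₂, hs, hs₂⟩ := ht.exists_factors hT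
  rw [hf] at h ⊢
  have e : 2 * k * (t + 1) = k * (2 * (t + 1)) := by ring
  rw [e]
  refine Nat.mul_le_mul (le_per_of_le_row (left_ne_zero_of_mul h) h₁ hc₁ fun r hr => ?_)
    (two_mul_succ_le_per (right_ne_zero_of_mul h) h₂ hc₂ fun y hy => ?_)
  · rw [hs r hr]; exact hrow r (hp.mem_iff.2 (by simp [hr]))
  · rw [hs₂ y hy]; exact hcol y (Finset.mem_sdiff.1 hy).1

lemma two_mul_le_per_triple {a b c : Y → ℕ} {T : Finset Y} {k t : ℕ} (h : per [a, b, c] T ≠ 0)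
    (hT : T.card = 3 + t) (hk : 3 ≤ k) (hrow : ∀ r ∈ [a, b, c], k ≤ ∑ y ∈ T, r y)
    (hcol : ∀ y ∈ T, 2 ≤ col [a, b, c] y) :
    2 * k * (t + 1) ≤ per [a, b, c] T + if k = 3 then 1 else 0 := by
  by_cases ht : Tight [a, b, c] T
  · exact (two_mul_le_per_of_tight h hT hrow hcol ht).trans (Nat.le_add_right _ _)
  simp only [List.mem_cons, List.not_mem_nil, or_false, forall_eq_or_imp, forall_eq] at hrow
  simp only [col_cons, col_nil, add_zero] at hcol
  obtain ⟨ha, hb, hc⟩ := hrow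
  have hp₁ : [a, b, c].Perm [b, c, a] := List.perm_append_comm (l₁ := [a]) (l₂ := [b, c])
  have hp₂ : [a, b, c].Perm [c, a, b] := List.perm_append_comm (l₁ := [a, b]) (l₂ := [c])
  have ht₁ : ¬ Tight [b, c, a] T := fun h' => ht (h'.perm hp₁.symm)
  have ht₂ : ¬ Tight [c, a, b] T := fun h' => ht (h'.perm hp₂.symm)
  have h₁ : per [b, c, a] T ≠ 0 := by rwa [← per_perm hp₁]
  have h₂ : per [c, a, b] T ≠ 0 := by rwa [← per_perm hp₂]
  by_cases hpa : (T \ cols [b, c] T).card ≠ 0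
  · refine (two_mul_le_per_of_private h ht hT hk hb hc (fun y hy => ?_) hpa).trans
      (Nat.le_add_right _ _)
    have := hcol y hy; omega
  by_cases hpb : (T \ cols [c, a] T).card ≠ 0
  · rw [per_perm hp₁]
    refine (two_mul_le_per_of_private h₁ ht₁ hT hk hc ha (fun y hy => ?_) hpb).trans
      (Nat.le_add_right _ _)
    have := hcol y hy; omega
  by_cases hpc : (T \ cols [a, b] T).card ≠ 0
  · rw [per_perm hp₂]
    refine (two_mul_le_per_of_private h₂ ht₂ hT hk ha hb (fun y hy => ?_) hpc).trans
      (Nat.le_add_right _ _)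
    have := hcol y hy; omega
  have hmem : ∀ u v : Y → ℕ, ¬ (T \ cols [u, v] T).card ≠ 0 → ∀ y ∈ T, u y ≠ 0 ∨ v y ≠ 0 := by
    intro u v h0 y hy
    have : y ∈ cols [u, v] T := (cols_eq_of_card_sdiff_eq_zero (not_not.1 h0)).symm ▸ hy
    have := one_le_col_of_mem_cols y this
    simp only [col_cons, col_nil] at this
    omega
  have hs : Spread a b c T :=
    ⟨fun y hy => ⟨hmem a b hpc y hy, hmem b c hpa y hy, hmem c a hpb y hy⟩,
      fun y => exists_ne_of_not_tight h ht (by simp) y,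
      fun y => exists_ne_of_not_tight h₁ ht₁ (by simp) y,
      fun y => exists_ne_of_not_tight h₂ ht₂ (by simp) y⟩
  have hE := hs.mul_le_per hT
  have hE2 : 2 * (3 + t) ≤ ∑ y ∈ T, a y + ∑ y ∈ T, b y + ∑ y ∈ T, c y := by
    rw [← Finset.sum_add_distrib, ← Finset.sum_add_distrib, ← hT, mul_comm, ← smul_eq_mul]
    refine Finset.card_nsmul_le_sum _ _ _ fun y hy => ?_
    have := hcol y hy; omega
  -- The spread bound suffices once the total is at least `2 * k + 4`, which `3 * k` is for `k ≥ 4`.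
  -- For `k = 3` the total can be 9 only if `t ≤ 1`: for `t = 0` the bound is 5, as needed, and for
  -- `t = 1` the bound 11 replaces 10.
  split_ifs with hk3
  · subst hk3
    by_cases h9 : t = 1 ∧ ∑ y ∈ T, a y + ∑ y ∈ T, b y + ∑ y ∈ T, c y = 9
    · obtain ⟨rfl, h9⟩ := h9
      have := hs.eleven_le_per hT (by omega) (by omega) (by omega)
      omega
    · have h9' : 9 ≤ ∑ y ∈ T, a y + ∑ y ∈ T, b y + ∑ y ∈ T, c y := by omega
      generalize ∑ y ∈ T, a y + ∑ y ∈ T, b y + ∑ y ∈ T, c y = E at *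
      rcases Nat.eq_zero_or_pos t with rfl | ht0
      · omega
      · have : 10 ≤ E := by omega
        nlinarith
  · have : 3 * k ≤ ∑ y ∈ T, a y + ∑ y ∈ T, b y + ∑ y ∈ T, c y := by omega
    generalize ∑ y ∈ T, a y + ∑ y ∈ T, b y + ∑ y ∈ T, c y = E at *
    have hk4 : 2 * k + 4 ≤ E := by omega
    nlinarith

end Triples

/-! ### Four or more rows: merging two rows. -/

section Merge

variable {Y : Type*}

lemma exists_perm_cons_of_col_eq_one {L : List (Y → ℕ)} {w : Y} (h : col L w = 1) :
    ∃ (s : Y → ℕ) (L' : List (Y → ℕ)), L.Perm (s :: L') ∧ s w = 1 ∧ col L' w = 0 := by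
  have h0 : ¬ col L w = 0 := by omega
  rw [col_eq_zero_iff] at h0
  push Not at h0
  obtain ⟨s, hs, hne⟩ := h0
  obtain ⟨l₁, l₂, rfl⟩ := List.append_of_mem hs
  refine ⟨s, l₁ ++ l₂, List.perm_middle, ?_⟩
  rw [col_perm List.perm_middle, col_cons] at h
  omega

variable [DecidableEq Y]

/-- Merging two rows along a column. -/
lemma per_merge_le (r s : Y → ℕ) (L : List (Y → ℕ)) {T : Finset Y} {w : Y} (hw : w ∈ T) :
    per ((fun y => r w * s y + s w * r y) :: L) (T.erase w) ≤ per (r :: s :: L) T := by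
  rw [per_cons r, ← Finset.add_sum_erase T _ hw, per_cons, per_cons s, Finset.mul_sum,
    ← Finset.sum_add_distrib]
  refine Finset.sum_le_sum fun y hy => ?_
  rw [Finset.mem_erase] at hy
  have h1 : s w * per L ((T.erase w).erase y) ≤ per (s :: L) (T.erase y) := by
    rw [Finset.erase_right_comm, per_cons]
    exact Finset.single_le_sum (f := fun z => s z * per L ((T.erase y).erase z))
      (fun _ _ => Nat.zero_le _) (Finset.mem_erase.2 ⟨hy.1.symm, hw⟩)
  have h2 := Nat.mul_le_mul_left (r y) h1
  linarith

/-- Private columns of `r` are handled by `mul_succ_le_per` for the other rows, at least three in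
number. Without them, either all columns of `L` have sum at least 2 and every minor is at least `2 *
(t + 1)`, or a column of sum 1 in `L` is met by `r` and one further row only, and merging these two
preserves all hypotheses. -/
lemma two_mul_succ_le_per_of_two_le_col {L : List (Y → ℕ)} {T : Finset Y} {k t : ℕ}
    (h : per L T ≠ 0) (hL : 3 ≤ L.length) (hT : T.card = L.length + t) (hk : 3 ≤ k)
    (hrow : ∀ r ∈ L, k ≤ ∑ y ∈ T, r y) (hcol : ∀ y ∈ T, 2 ≤ col L y) :
    2 * k * (t + 1) ≤ per L T + if k = 3 then 1 else 0 := by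
  induction hn : L.length generalizing L T with
  | zero => omega
  | succ n ih =>
    rcases Nat.lt_or_ge 3 L.length with hL4 | hL3
    swap
    · obtain ⟨a, b, c, rfl⟩ := List.length_eq_three.1 (le_antisymm hL3 hL)
      exact two_mul_le_per_triple h hT hk hrow hcol
    by_cases ht : Tight L T
    · exact (two_mul_le_per_of_tight h hT hrow hcol ht).trans (Nat.le_add_right _ _)
    obtain _ | ⟨r, L⟩ := L
    · simp at hL
    simp only [List.length_cons] at hn hL4
    obtain ⟨hp, hc⟩ := card_cols_eq h hT
    rcases Nat.eq_zero_or_pos (T \ cols L T).card with h0 | h0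
    swap
    · refine le_trans ?_ (Nat.le_add_right _ _)
      have h1 := mul_succ_le_per (k := k) (per_cols_ne_zero h) (by omega) hc
        (fun s hs => by rw [sum_cols hs]; exact hrow s (by simp [hs])) one_le_col_of_mem_cols
      rw [per_cons_eq]
      refine le_trans ?_ (Nat.le_add_right _ _)
      refine le_trans ?_ (Nat.mul_le_mul (card_sdiff_cols_le hcol) h1)
      have h2 := add_one_le_mul h0 hp
      rw [show t + 1 - (T \ cols L T).card + 1 = t + 2 - (T \ cols L T).card by omega]
      nlinarith [Nat.mul_le_mul_left (2 * k) h2]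
    have hZ := cols_eq_of_card_sdiff_eq_zero h0
    by_cases hw : ∃ w ∈ T, col L w = 1
    · obtain ⟨w, hwT, hw⟩ := hw
      obtain ⟨s, L', hperm, hsw, hw0⟩ := exists_perm_cons_of_col_eq_one hw
      have hrw : 1 ≤ r w := by have := hcol w hwT; simp at this; omega
      have hlen := hperm.length_eq
      rw [List.length_cons] at hlen
      have h1 : per (s :: L') (T.erase w) ≠ 0 := by
        rw [← per_perm hperm]; exact per_erase_ne_zero h ht w
      rw [per_perm (hperm.cons r)]
      refine le_trans (ih ?_ ?_ ?_ ?_ ?_ ?_) (Nat.add_le_add_right (per_merge_le r s L' hwT) _)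
      · obtain ⟨y, hy, hsy, hne⟩ := exists_edge_of_per_ne_zero h1
        rw [per_cons]
        intro hs0
        have := Finset.sum_eq_zero_iff.1 hs0 y hy
        rcases Nat.mul_eq_zero.1 this with h2 | h2
        · have := Nat.mul_pos hrw (Nat.pos_of_ne_zero hsy)
          omega
        · exact hne h2
      · simp only [List.length_cons]; omega
      · rw [Finset.card_erase_of_mem hwT, hT]; simp only [List.length_cons]; omega
      · intro q hq
        rw [List.mem_cons] at hq
        rcases hq with rfl | hq
        · have h2 := hrow s (by simp [hperm.mem_iff])
          -- In the merged row, `s` contributes at least `k - 1`, since it loses only its unit in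
          -- `w`; `r` supplies the missing unit because it meets another column.
          have h3 := sum_erase_ne_zero h ht (by rintro rfl; simp at hL4) w
          rw [← Finset.add_sum_erase T s hwT] at h2
          rw [Finset.sum_add_distrib, ← Finset.mul_sum, ← Finset.mul_sum, hsw]
          have := Nat.le_mul_of_pos_left (∑ y ∈ T.erase w, s y) hrw
          omega
        · have h2 := hrow q (by simp [hperm.mem_iff, hq])
          rwa [← Finset.add_sum_erase T q hwT, col_eq_zero_iff.1 hw0 q hq, zero_add] at h2
      · intro y hy
        have h2 := hcol y (Finset.mem_of_mem_erase hy)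
        rw [col_cons, col_perm hperm, col_cons] at h2
        rw [col_cons, hsw]
        have := Nat.le_mul_of_pos_left (s y) hrw
        omega
      · simp only [List.length_cons]; omega
    · push Not at hw
      refine le_trans ?_ (Nat.le_add_right _ _)
      rw [mul_comm 2 k, mul_assoc]
      refine mul_le_per_cons (hrow r (by simp)) fun y hy _ =>
        two_mul_succ_le_per (per_erase_ne_zero h ht y) (by rintro rfl; simp at hL4) ?_ fun z hz => ?_
      · rw [Finset.card_erase_of_mem hy, hT]; simp only [List.length_cons]; omega
      · have hzT := Finset.mem_of_mem_erase hz
        have h2 := one_le_col_of_mem_cols (L := L) (T := T) z (hZ.symm ▸ hzT)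
        have h3 := hw z hzT
        omega

end Merge

/-! ### Maximum matchings as a permanent. -/

section Translation

variable {X Y E : Type*} [DecidableEq X]

lemma IsMatching.card_image_left {G : Bigraph X Y E} {M : Finset E} (h : G.IsMatching M) :
    (M.image G.left).card = M.card := by
  refine Finset.card_image_of_injOn fun e he f hf hef => ?_
  by_contra hne
  exact (h e he f hf hne).1 hef

variable [DecidableEq Y] [Fintype E] (G : Bigraph X Y E)

/-- The number of edges joining `x` and `y`. -/
def mult (x : X) (y : Y) : ℕ := (Finset.univ.filter fun e => G.left e = x ∧ G.right e = y).card

open Classical in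
/-- The matchings that cover the vertices in `A` and no other vertex of `X`, and only vertices
in `T`. -/
noncomputable def matchings (A : Finset X) (T : Finset Y) : Finset (Finset E) :=
  Finset.univ.filter fun M => G.IsMatching M ∧ M.image G.left = A ∧ ∀ e ∈ M, G.right e ∈ T

lemma mem_matchings {A : Finset X} {T : Finset Y} {M : Finset E} :
    M ∈ G.matchings A T ↔ G.IsMatching M ∧ M.image G.left = A ∧ ∀ e ∈ M, G.right e ∈ T := by
  simp [matchings]

lemma sum_mult_mul (x : X) (T : Finset Y) (g : Y → ℕ) :
    ∑ y ∈ T, G.mult x y * g y =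
      ∑ e ∈ Finset.univ.filter (fun e => G.left e = x ∧ G.right e ∈ T), g (G.right e) := by
  rw [← Finset.sum_fiberwise_of_maps_to (t := T) (g := G.right)]
  · refine Finset.sum_congr rfl fun y hy => ?_
    rw [Finset.sum_congr rfl (g := fun _ => g y), Finset.sum_const, smul_eq_mul, mult]
    · congr 2
      ext e
      simp only [Finset.mem_filter, Finset.mem_univ, true_and]
      constructor
      · rintro ⟨h1, h2⟩; exact ⟨⟨h1, h2 ▸ hy⟩, h2⟩
      · rintro ⟨⟨h1, -⟩, h2⟩; exact ⟨h1, h2⟩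
    · intro e he
      rw [(Finset.mem_filter.1 he).2]
  · intro e he
    exact (Finset.mem_filter.1 he).2.2

/-- Splitting off the edge at the first vertex of the list mirrors the expansion of `per` along its
first row. -/
lemma card_matchings (l : List X) (hl : l.Nodup) (T : Finset Y) :
    (G.matchings l.toFinset T).card = per (l.map G.mult) T := by
  classical
  induction l generalizing T with
  | nil =>
    rw [List.map_nil, per_nil, Finset.card_eq_one]
    refine ⟨∅, ?_⟩
    ext M
    rw [mem_matchings, Finset.mem_singleton]
    constructor
    · rintro ⟨-, h, -⟩
      simpa using h
    · rintro rfl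
      simp [IsMatching]
  | cons x l ih =>
    rw [List.nodup_cons] at hl
    rw [List.map_cons, per_cons, sum_mult_mul]
    simp only [← ih hl.2]
    rw [← Finset.card_sigma]
    symm
    refine Finset.card_bij (fun p _ => insert p.1 p.2) ?_ ?_ ?_
    · rintro ⟨e, M⟩ h
      simp only [Finset.mem_sigma, Finset.mem_filter, Finset.mem_univ, true_and,
        mem_matchings, Finset.mem_erase] at h
      obtain ⟨⟨h1, h2⟩, h3, h4, h5⟩ := h
      have hne : ∀ f ∈ M, G.left e ≠ G.left f := by
        intro f hf heq
        have : G.left f ∈ l.toFinset := h4 ▸ Finset.mem_image_of_mem _ hf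
        rw [← heq, h1] at this
        exact hl.1 (by simpa using this)
      rw [mem_matchings]
      refine ⟨?_, ?_, ?_⟩
      · intro f hf g hg hfg
        rw [Finset.mem_insert] at hf hg
        rcases hf with rfl | hf <;> rcases hg with rfl | hg
        · exact absurd rfl hfg
        · exact ⟨hne g hg, (h5 g hg).1.symm⟩
        · exact ⟨(hne f hf).symm, (h5 f hf).1⟩
        · exact h3 f hf g hg hfg
      · rw [Finset.image_insert, h4, h1, List.toFinset_cons]
      · intro f hf
        rw [Finset.mem_insert] at hf
        rcases hf with rfl | hf
        · exact h2
        · exact (h5 f hf).2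
    · rintro ⟨e, M⟩ h ⟨e', M'⟩ h' heq
      simp only [Finset.mem_sigma, Finset.mem_filter, Finset.mem_univ, true_and,
        mem_matchings, Finset.mem_erase] at h h' heq
      have key : ∀ (M : Finset E), M.image G.left = l.toFinset → ∀ f ∈ M, G.left f ≠ x := by
        intro M hM f hf hfx
        have : G.left f ∈ l.toFinset := hM ▸ Finset.mem_image_of_mem _ hf
        rw [hfx] at this
        exact hl.1 (by simpa using this)
      have hee : e = e' := by
        have : e ∈ insert e' M' := heq ▸ Finset.mem_insert_self e M
        rw [Finset.mem_insert] at this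
        rcases this with h1 | h1
        · exact h1
        · exact absurd h.1.1 (key M' h'.2.2.1 e h1)
      subst hee
      have h1 : e ∉ M := fun he => key M h.2.2.1 e he h.1.1
      have h2 : e ∉ M' := fun he => key M' h'.2.2.1 e he h.1.1
      have : M = M' := by
        rw [← Finset.erase_insert h1, heq, Finset.erase_insert h2]
      rw [this]
    · intro M hM
      rw [mem_matchings, List.toFinset_cons] at hM
      obtain ⟨h1, h2, h3⟩ := hM
      have hx : x ∈ M.image G.left := h2 ▸ Finset.mem_insert_self x _
      obtain ⟨e, he, hex⟩ := Finset.mem_image.1 hx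
      refine ⟨⟨e, M.erase e⟩, ?_, Finset.insert_erase he⟩
      simp only [Finset.mem_sigma, Finset.mem_filter, Finset.mem_univ, true_and,
        mem_matchings, Finset.mem_erase]
      refine ⟨⟨hex, h3 e he⟩, ?_, ?_, ?_⟩
      · intro f hf g hg hfg
        exact h1 f (Finset.mem_of_mem_erase hf) g (Finset.mem_of_mem_erase hg) hfg
      · ext z
        rw [Finset.mem_image]
        constructor
        · rintro ⟨f, hf, rfl⟩
          rw [Finset.mem_erase] at hf
          have h4 : G.left f ∈ insert x l.toFinset := h2 ▸ Finset.mem_image_of_mem _ hf.2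
          rw [Finset.mem_insert] at h4
          rcases h4 with h4 | h4
          · exact absurd (h4.trans hex.symm) (h1 f hf.2 e he hf.1).1
          · exact h4
        · intro hz
          have h4 : z ∈ M.image G.left := h2 ▸ Finset.mem_insert_of_mem hz
          obtain ⟨f, hf, rfl⟩ := Finset.mem_image.1 h4
          refine ⟨f, Finset.mem_erase.2 ⟨?_, hf⟩, rfl⟩
          rintro rfl
          rw [hex] at hz
          exact hl.1 (by simpa using hz)
      · intro f hf
        exact ⟨(h1 f hf.2 e he hf.1).2, h3 f hf.2⟩

lemma degX_eq [Fintype Y] (x : X) : G.degX x = ∑ y, G.mult x y := by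
  have := G.sum_mult_mul x Finset.univ fun _ => 1
  simp only [mul_one, Finset.mem_univ, and_true, Finset.sum_const, smul_eq_mul] at this
  rw [this, degX, Set.ncard_eq_toFinset_card']
  congr 1
  ext e
  simp

lemma degY_eq [Fintype X] (y : Y) : G.degY y = ∑ x, G.mult x y := by
  rw [degY, Set.ncard_eq_toFinset_card',
    Finset.card_eq_sum_card_fiberwise (f := G.left) (t := Finset.univ) (by simp)]
  refine Finset.sum_congr rfl fun x _ => ?_
  rw [mult]
  congr 1
  ext e
  simp [and_comm]

lemma mult_ne_zero_iff {x : X} {y : Y} :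
    G.mult x y ≠ 0 ↔ ∃ e, G.left e = x ∧ G.right e = y := by
  rw [mult, Finset.card_ne_zero]
  simp [Finset.Nonempty]

lemma hallCondition_iff [Fintype X] [Fintype Y] :
    G.HallCondition ↔ ∃ f : X → Y, Function.Injective f ∧ ∀ x, G.mult x (f x) ≠ 0 := by
  have := Finset.all_card_le_biUnion_card_iff_exists_injective
    fun x => Finset.univ.filter fun y => G.mult x y ≠ 0
  simp only [Finset.mem_filter, Finset.mem_univ, true_and] at this
  rw [← this]
  have hN : ∀ S : Finset X, G.nbhd (S : Set X) =
      (S.biUnion fun x => Finset.univ.filter fun y => G.mult x y ≠ 0 : Finset Y) := by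
    intro S
    ext y
    simp only [nbhd, Set.mem_ofPred_eq, Finset.mem_coe, Finset.mem_biUnion, Finset.mem_filter,
      Finset.mem_univ, true_and, mult_ne_zero_iff]
    constructor
    · rintro ⟨e, h1, h2⟩; exact ⟨_, h1, e, rfl, h2⟩
    · rintro ⟨_, h1, e, rfl, h2⟩; exact ⟨e, h1, h2⟩
  constructor
  · intro h S
    have := h (S : Set X)
    rwa [hN, Set.ncard_coe_finset, Set.ncard_coe_finset] at this
  · intro h S
    have h1 := h S.toFinite.toFinset
    have h2 := hN S.toFinite.toFinset
    rw [Set.Finite.coe_toFinset] at h2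
    rw [h2, Set.ncard_coe_finset, Set.ncard_eq_toFinset_card S]
    exact h1

/-- Under Hall's Condition, the number of maximum matchings is a permanent. -/
lemma numMaxMatchings_eq [Fintype X] [Fintype Y] (h : G.HallCondition) :
    G.numMaxMatchings = per ((Finset.univ : Finset X).toList.map G.mult) Finset.univ ∧
      G.numMaxMatchings ≠ 0 := by
  classical
  obtain ⟨f, hf, hfm⟩ := G.hallCondition_iff.1 h
  simp only [mult_ne_zero_iff] at hfm
  choose g hg hg' using hfm
  have hM₀ : Finset.univ.image g ∈ G.matchings Finset.univ Finset.univ := by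
    rw [mem_matchings]
    refine ⟨?_, ?_, by simp⟩
    · intro e he e' he' hne
      obtain ⟨x, -, rfl⟩ := Finset.mem_image.1 he
      obtain ⟨x', -, rfl⟩ := Finset.mem_image.1 he'
      have hx : x ≠ x' := fun hx => hne (hx ▸ rfl)
      rw [hg, hg, hg', hg']
      exact ⟨hx, hf.ne hx⟩
    · ext x
      simp only [Finset.mem_image, Finset.mem_univ, true_and, exists_exists_eq_and, iff_true]
      exact ⟨x, hg x⟩
  -- Since one matching covers `X`, a matching is maximum exactly if it covers `X`.
  have hset : {M : Finset E | G.IsMaximumMatching M} =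
      (G.matchings Finset.univ Finset.univ : Finset (Finset E)) := by
    ext M
    rw [Set.mem_ofPred_eq, Finset.mem_coe, mem_matchings]
    constructor
    · rintro ⟨h1, h2⟩
      refine ⟨h1, ?_, by simp⟩
      rw [mem_matchings] at hM₀
      have h3 := h2 _ hM₀.1
      rw [← h1.card_image_left, ← hM₀.1.card_image_left, hM₀.2.1] at h3
      exact Finset.eq_univ_of_card _ (le_antisymm (Finset.card_le_univ _) h3)
    · rintro ⟨h1, h2, -⟩
      refine ⟨h1, fun M' hM' => ?_⟩
      rw [← h1.card_image_left, ← hM'.card_image_left, h2]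
      exact Finset.card_le_univ _
  rw [numMaxMatchings, hset, Set.ncard_coe_finset]
  constructor
  · rw [← G.card_matchings _ (Finset.nodup_toList _), Finset.toList_toFinset]
  · exact Finset.card_ne_zero_of_mem hM₀

end Translation

/-! ### The extremal graphs. -/

section Constructions

lemma minDegX_eq {X Y E : Type*} (G : Bigraph X Y E) {k : ℕ} (h : ∀ x, k ≤ G.degX x)
    (h' : ∃ x, G.degX x = k) : G.minDegX = k := by
  obtain ⟨x, hx⟩ := h'
  have : Nonempty X := ⟨x⟩
  exact le_antisymm (hx ▸ ciInf_le (OrderBot.bddBelow _) x) (le_ciInf h)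

lemma minDegY_eq {X Y E : Type*} (G : Bigraph X Y E) {k : ℕ} (h : ∀ y, k ≤ G.degY y)
    (h' : ∃ y, G.degY y = k) : G.minDegY = k := by
  obtain ⟨y, hy⟩ := h'
  have : Nonempty Y := ⟨y⟩
  exact le_antisymm (hy ▸ ciInf_le (OrderBot.bddBelow _) y) (le_ciInf h)

lemma mult_ofMult {X Y : Type*} [Fintype X] [Fintype Y] [DecidableEq X] [DecidableEq Y]
    (m : X → Y → ℕ) : (ofMult m).mult = m := by
  ext x y
  have : (Finset.univ.filter fun e : MultEdge m => (ofMult m).left e = x ∧ (ofMult m).right e = y) =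
      (Finset.univ : Finset (Fin (m x y))).image fun i => (⟨(x, y), i⟩ : MultEdge m) := by
    ext ⟨⟨x', y'⟩, i⟩
    rw [Finset.mem_filter]
    simp only [ofMult, Finset.mem_univ, true_and, Finset.mem_image]
    constructor
    · rintro ⟨rfl, rfl⟩
      exact ⟨i, rfl⟩
    · rintro ⟨j, hj⟩
      have := congrArg Sigma.fst hj
      simp only [Prod.mk.injEq] at this
      exact ⟨this.1.symm, this.2.symm⟩
  rw [mult, this, Finset.card_image_of_injective _ (fun i j hij => by simpa using hij)]
  simp

lemma per_of_triangular {ι Y : Type*} [DecidableEq Y] (l : List ι) (R : ι → Y → ℕ) (g : ι → Y)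
    (hl : l.Pairwise fun i j => g i ≠ g j ∧ R i (g j) = 0) :
    per (l.map R) (l.map g).toFinset = (l.map fun i => R i (g i)).prod := by
  induction l with
  | nil => simp
  | cons i l ih =>
    rw [List.pairwise_cons] at hl
    have hi : g i ∉ (l.map g).toFinset := by
      simp only [List.mem_toFinset, List.mem_map, not_exists, not_and]
      exact fun j hj h => (hl.1 j hj).1 h.symm
    rw [List.map_cons, List.map_cons, List.map_cons, List.toFinset_cons, per_cons,
      Finset.sum_insert hi, Finset.erase_insert hi, ih hl.2, List.prod_cons,
      Finset.sum_eq_zero, add_zero]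
    intro y hy
    simp only [List.mem_toFinset, List.mem_map] at hy
    obtain ⟨j, hj, rfl⟩ := hy
    rw [(hl.1 j hj).2, zero_mul]

/-- The rows other than that of `x^*` form a tight block, triangular with diagonal `k, 1, …, 1`. It
leaves `x^*` the `t + 1` new columns, with `c` edges to each. -/
lemma ofMult_multG_spec (c n k t : ℕ) (hc : 1 ≤ c) (hn : 3 ≤ n) (hk : 1 ≤ k) :
    (ofMult (multG c n k t)).HallCondition ∧ (ofMult (multG c n k t)).minDegX = k ∧
      (ofMult (multG c n k t)).minDegY = c ∧
      (ofMult (multG c n k t)).numMaxMatchings = c * k * (t + 1) := by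
  let i₀ : Fin (n - 1) := ⟨0, by omega⟩
  have hi₀ : ∀ i : Fin (n - 1), i.val = 0 ↔ i = i₀ := fun i => by simp [i₀, Fin.ext_iff]
  have hH : (ofMult (multG c n k t)).HallCondition := by
    rw [hallCondition_iff, mult_ofMult]
    refine ⟨Sum.map id fun _ => 0, ?_, ?_⟩
    · rintro (i | i) (j | j) h <;> simp_all
    · rintro (i | i) <;> simp [multG, multH]
      omega
  refine ⟨hH, minDegX_eq _ ?_ ?_, minDegY_eq _ ?_ ?_, ?_⟩
  · rintro (i | i)
    · rw [degX_eq, mult_ofMult, Fintype.sum_sum_type]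
      simp only [multG, multH, hi₀, Finset.sum_add_distrib, Finset.sum_ite_eq, Finset.sum_ite_eq',
        Finset.mem_univ, if_true]
      omega
    · rw [degX_eq, mult_ofMult, Fintype.sum_sum_type]
      simp only [multG, hi₀, Finset.sum_add_distrib, Finset.sum_ite_eq',
        Finset.mem_univ, if_true, Finset.sum_const, Finset.card_univ, Fintype.card_fin, smul_eq_mul]
      have : (n - 1) * c + (t + 1) * c = c * (n + t) := by
        rw [← add_mul, mul_comm]; congr 1; omega
      omega
  · refine ⟨.inl i₀, ?_⟩
    rw [degX_eq, mult_ofMult, Fintype.sum_sum_type]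
    simp only [multG, multH, hi₀, Finset.sum_add_distrib, Finset.sum_ite_eq, Finset.sum_ite_eq',
      Finset.mem_univ, if_true, Finset.sum_const_zero]
    omega
  · rintro (j | j) <;> rw [degY_eq, mult_ofMult, Fintype.sum_sum_type] <;>
      simp only [multG, Finset.univ_unique, Finset.sum_singleton] <;> omega
  · refine ⟨.inr 0, ?_⟩
    rw [degY_eq, mult_ofMult, Fintype.sum_sum_type]
    simp [multG]
  · rw [(numMaxMatchings_eq _ hH).1, mult_ofMult]
    have hperm : (Finset.univ : Finset (Fin (n - 1) ⊕ Unit)).toList.Perm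
        ((List.finRange (n - 1)).map Sum.inl ++ [Sum.inr ()]) := by
      rw [List.perm_ext_iff_of_nodup (Finset.nodup_toList _)]
      · rintro (i | i) <;> simp
      · rw [List.nodup_append]
        refine ⟨(List.nodup_finRange _).map Sum.inl_injective, by simp, ?_⟩
        simp
    rw [per_perm (hperm.map _), List.map_append, List.map_map]
    rw [per_append_of_tight (T₁ := ((List.finRange (n - 1)).map Sum.inl).toFinset)
      (Finset.subset_univ _)]
    · have h1 := per_of_triangular (List.finRange (n - 1)) (multG c n k t ∘ Sum.inl) Sum.inl
        ((List.pairwise_lt_finRange _).imp fun {i j} hij => by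
          refine ⟨fun h => hij.ne (Sum.inl_injective h), ?_⟩
          have : j.val ≠ 0 := by have := Fin.lt_def.1 hij; omega
          simp [multG, multH, hij.ne, this])
      rw [h1]
      have h2 : ((List.finRange (n - 1)).map fun i =>
          (multG c n k t ∘ Sum.inl) i (Sum.inl i)).prod = k := by
        rw [← List.ofFn_eq_map, List.prod_ofFn]
        have : ∀ i : Fin (n - 1), (multG c n k t ∘ Sum.inl) i (Sum.inl i) =
            if i = i₀ then k else 1 := by
          intro i
          simp only [multG, multH, Function.comp_apply, hi₀, if_true]
          split_ifs <;> omega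
        simp only [this, Finset.prod_ite_eq', Finset.mem_univ, if_true]
      have h3 : (Finset.univ \ ((List.finRange (n - 1)).map Sum.inl).toFinset :
          Finset (Fin (n - 1) ⊕ Fin (t + 1))) = Finset.univ.image Sum.inr := by
        ext (i | i) <;> simp
      rw [h2, h3, List.map_singleton, per_single,
        Finset.sum_image fun i _ j _ h => Sum.inr_injective h]
      simp only [multG, Finset.sum_const, Finset.card_univ, Fintype.card_fin, smul_eq_mul]
      ring
    · rw [List.toFinset_card_of_nodup ((List.nodup_finRange _).map Sum.inl_injective)]
      simp
    · intro r hr y _ hne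
      simp only [List.mem_map, Function.comp_apply] at hr
      obtain ⟨i, -, rfl⟩ := hr
      obtain j | j := y
      · simp
      · simp [multG] at hne

/-- The permanent is `k ^ 2 - (t + 1) - (k - t - 1) ^ 2`, the product of the row sums minus the
choices of a common column. -/
lemma graphL_spec (k t : ℕ) (h : t + 1 < k) :
    (graphL k t).HallCondition ∧ (graphL k t).minDegX = k ∧ (graphL k t).minDegY = 2 ∧
      ((graphL k t).numMaxMatchings : ℤ) = (2 * (k : ℤ) - t - 2) * (t + 1) := by
  have hm : (graphL k t).mult = multL k t := mult_ofMult _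
  have hsum : ∀ x, ∑ y, multL k t x y = k := fun x => by
    rw [Fintype.sum_option]
    simp only [multL, Finset.sum_const, Finset.card_univ, Fintype.card_fin, smul_eq_mul]
    omega
  have hH : (graphL k t).HallCondition := by
    rw [hallCondition_iff, hm]
    refine ⟨![none, some 0], ?_, ?_⟩
    · intro i j hij
      fin_cases i <;> fin_cases j <;> simp_all
    · intro i
      fin_cases i <;> simp [multL]
      omega
  refine ⟨hH, minDegX_eq _ (fun x => ?_) ⟨0, ?_⟩, minDegY_eq _ ?_ ⟨some 0, ?_⟩, ?_⟩
  · rw [degX_eq, hm, hsum]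
  · rw [degX_eq, hm, hsum]
  · rintro (_ | j) <;> rw [degY_eq, hm, Fin.sum_univ_two] <;> simp only [multL] <;> omega
  · rw [degY_eq, hm, Fin.sum_univ_two]; simp [multL]
  · rw [(numMaxMatchings_eq _ hH).1, hm]
    have hperm : (Finset.univ : Finset (Fin 2)).toList.Perm [0, 1] := by
      rw [List.perm_ext_iff_of_nodup (Finset.nodup_toList _) (by simp)]
      intro i
      fin_cases i <;> simp
    rw [per_perm (hperm.map _)]
    simp only [List.map_cons, List.map_nil]
    have := per_pair_add (multL k t 0) (multL k t 1) Finset.univ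
    rw [hsum, hsum, Fintype.sum_option] at this
    simp only [multL, mul_one, Finset.sum_const, Finset.card_univ, Fintype.card_fin,
      smul_eq_mul] at this
    obtain ⟨s, rfl⟩ := Nat.exists_eq_add_of_lt h
    rw [show t + 1 + s + 1 - t - 1 = s + 1 by omega] at this
    zify at this ⊢
    linear_combination this

lemma graph7_spec : graph7.HallCondition ∧ graph7.minDegX = 3 ∧ graph7.minDegY = 2 ∧
    graph7.numMaxMatchings = 2 * 3 * (1 + 1) - 1 := by
  have hm : graph7.mult = mult7 := mult_ofMult _
  have hH : graph7.HallCondition := by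
    rw [hallCondition_iff, hm]
    exact ⟨some, Option.some_injective _, by decide⟩
  refine ⟨hH, minDegX_eq _ (fun x => ?_) ⟨0, ?_⟩, minDegY_eq _ (fun y => ?_) ⟨some 0, ?_⟩, ?_⟩
  · rw [degX_eq, hm]; revert x; decide
  · rw [degX_eq, hm]; decide
  · rw [degY_eq, hm]; revert y; decide
  · rw [degY_eq, hm]; decide
  · rw [(numMaxMatchings_eq _ hH).1, hm]
    have hperm : (Finset.univ : Finset (Fin 3)).toList.Perm [0, 1, 2] := by
      rw [List.perm_ext_iff_of_nodup (Finset.nodup_toList _) (by simp)]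
      intro i
      fin_cases i <;> simp
    rw [per_perm (hperm.map _)]
    decide

end Constructions

/-! ### Assembly of the lower bounds. -/

section LowerBound

lemma le_numMaxMatchings {X Y E : Type*} [Fintype X] [Fintype Y] [Fintype E] (G : Bigraph X Y E)
    (k t : ℕ) (hX : 2 ≤ Fintype.card X) (hk : k ≤ G.minDegX)
    (hY : Fintype.card Y = Fintype.card X + t) (hH : G.HallCondition) :
    (1 ≤ G.minDegY → ¬ (Fintype.card X = 2 ∧ 1 ≤ t ∧ G.minDegY = 1 ∧ 2 ≤ k) →
      k * (t + 1) ≤ G.numMaxMatchings) ∧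
    (2 ≤ G.minDegY → Fintype.card X = 2 →
      (2 * (k : ℤ) - t - 2) * (t + 1) ≤ G.numMaxMatchings) ∧
    (2 ≤ G.minDegY → 3 ≤ Fintype.card X → 3 ≤ k →
      2 * k * (t + 1) ≤ G.numMaxMatchings + if k = 3 then 1 else 0) := by
  classical
  obtain ⟨hΦ, hne⟩ := G.numMaxMatchings_eq hH
  rw [hΦ] at hne ⊢
  have hlen : ((Finset.univ : Finset X).toList.map G.mult).length = Fintype.card X := by simp
  have hT : (Finset.univ : Finset Y).card =
      ((Finset.univ : Finset X).toList.map G.mult).length + t := by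
    rw [hlen, Finset.card_univ, hY]
  have hrow : ∀ r ∈ (Finset.univ : Finset X).toList.map G.mult, k ≤ ∑ y, r y := by
    intro r hr
    obtain ⟨x, -, rfl⟩ := List.mem_map.1 hr
    rw [← degX_eq]
    exact hk.trans (ciInf_le (OrderBot.bddBelow _) x)
  have hcol : ∀ c, c ≤ G.minDegY → ∀ y ∈ (Finset.univ : Finset Y),
      c ≤ col ((Finset.univ : Finset X).toList.map G.mult) y := by
    intro c hc y _
    rw [col, List.map_map]
    have : ((Finset.univ : Finset X).toList.map ((fun r : Y → ℕ => r y) ∘ G.mult)).sum =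
        G.degY y := by
      rw [degY_eq]; exact Finset.sum_map_toList _ _
    rw [this]
    exact hc.trans (ciInf_le (OrderBot.bddBelow _) y)
  rw [← hlen] at hX ⊢
  generalize (Finset.univ : Finset X).toList.map G.mult = L at *
  refine ⟨fun h1 hex => ?_, fun h2 hL => ?_, fun h2 hL hk3 => ?_⟩
  · rcases Nat.lt_or_ge L.length 3 with h3 | h3
    · rcases Nat.eq_zero_or_pos k with rfl | hk0
      · simp
      -- For `k ≥ 1` these are exactly the cases with `k + t = k * (t + 1)`. In all others the
      -- excluded exception forces column sums of at least 2.
      by_cases hkt : k = 1 ∨ t = 0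
      · have := add_le_per hne hX hT hk0 hrow (hcol 1 h1)
        rcases hkt with rfl | rfl <;> omega
      · have h2 : 2 ≤ G.minDegY := by
          by_contra hlt
          exact hex ⟨by omega, by omega, by omega, by omega⟩
        have hcol2 := hcol 2 h2
        obtain ⟨a, b, rfl⟩ := List.length_eq_two.1 (show L.length = 2 by omega)
        exact mul_succ_le_per_pair hne hT (hrow a (by simp)) (hrow b (by simp))
          fun y hy => by simpa using hcol2 y hy
    · exact mul_succ_le_per hne h3 hT hrow (hcol 1 h1)
  · have hcol2 := hcol 2 h2
    obtain ⟨a, b, rfl⟩ := List.length_eq_two.1 hL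
    exact two_mul_sub_mul_le_per_pair hT (hrow a (by simp)) (hrow b (by simp))
      fun y hy => by simpa using hcol2 y hy
  · exact two_mul_succ_le_per_of_two_le_col hne hL hT hk3 hrow (hcol 2 h2)

end LowerBound

end Bigraph

theorem theorem1p4 :
    -- the lower bounds
    (∀ {X Y E : Type*} [Fintype X] [Fintype Y] [Fintype E] (G : Bigraph X Y E) (k t : ℕ),
      2 ≤ Fintype.card X → k ≤ G.minDegX → Fintype.card Y = Fintype.card X + t →
      G.HallCondition →
        (1 ≤ G.minDegY →
          ¬ (Fintype.card X = 2 ∧ 1 ≤ t ∧ G.minDegY = 1 ∧ 2 ≤ k) →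
            k * (t + 1) ≤ G.numMaxMatchings) ∧
        (2 ≤ G.minDegY → Fintype.card X = 2 →
          (2 * (k : ℤ) - t - 2) * (t + 1) ≤ G.numMaxMatchings) ∧
        (2 ≤ G.minDegY → 3 ≤ Fintype.card X → k = 3 →
          2 * (k : ℤ) * (t + 1) - 1 ≤ G.numMaxMatchings) ∧
        (2 ≤ G.minDegY → 3 ≤ Fintype.card X → 4 ≤ k →
          2 * k * (t + 1) ≤ G.numMaxMatchings)) ∧
    -- sharpness of the first and the last bound; the parts have sizes `n` and `n + t`
    (∀ n k t : ℕ, 3 ≤ n → 1 ≤ k →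
      Fintype.card (Fin (n - 1) ⊕ Unit) = n ∧
      Fintype.card (Fin (n - 1) ⊕ Fin (t + 1)) = n + t ∧
      ((Bigraph.graphG n k t).HallCondition ∧ (Bigraph.graphG n k t).minDegX = k ∧
        (Bigraph.graphG n k t).minDegY = 1 ∧
        (Bigraph.graphG n k t).numMaxMatchings = k * (t + 1)) ∧
      ((Bigraph.graphG' n k t).HallCondition ∧ (Bigraph.graphG' n k t).minDegX = k ∧
        (Bigraph.graphG' n k t).minDegY = 2 ∧
        (Bigraph.graphG' n k t).numMaxMatchings = 2 * k * (t + 1))) ∧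
    -- sharpness of the bound for `|X| = 2`; the parts have sizes `2` and `2 + t`
    (∀ k t : ℕ, t + 1 < k →
      Fintype.card (Option (Fin (t + 1))) = 2 + t ∧
      (Bigraph.graphL k t).HallCondition ∧ (Bigraph.graphL k t).minDegX = k ∧
      (Bigraph.graphL k t).minDegY = 2 ∧
      ((Bigraph.graphL k t).numMaxMatchings : ℤ) = (2 * (k : ℤ) - t - 2) * (t + 1)) ∧
    -- sharpness of the bound for `k = 3`, with `t = 1`; the parts have sizes `3` and `4`
    (Fintype.card (Option (Fin 3)) = 3 + 1 ∧
      Bigraph.graph7.HallCondition ∧ Bigraph.graph7.minDegX = 3 ∧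
      Bigraph.graph7.minDegY = 2 ∧ Bigraph.graph7.numMaxMatchings = 2 * 3 * (1 + 1) - 1) := by
  refine ⟨?_, ?_, ?_, ?_⟩
  · intro X Y E _ _ _ G k t hX hk hY hH
    obtain ⟨h1, h2, h3⟩ := G.le_numMaxMatchings k t hX hk hY hH
    refine ⟨h1, h2, fun hδ hX3 hk3 => ?_, fun hδ hX3 hk4 => ?_⟩
    · have := h3 hδ hX3 hk3.ge
      rw [if_pos hk3] at this
      zify at this
      linarith
    · have := h3 hδ hX3 (by omega)
      rwa [if_neg (by omega), add_zero] at this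
  · intro n k t hn hk
    have h1 := Bigraph.ofMult_multG_spec 1 n k t le_rfl hn hk
    rw [one_mul] at h1
    refine ⟨?_, ?_, h1, Bigraph.ofMult_multG_spec 2 n k t one_le_two hn hk⟩
    · simp only [Fintype.card_sum, Fintype.card_fin, Fintype.card_unit]
      omega
    · simp only [Fintype.card_sum, Fintype.card_fin]
      omega
  · intro k t h
    refine ⟨?_, Bigraph.graphL_spec k t h⟩
    simp only [Fintype.card_option, Fintype.card_fin]
    omega
  · exact ⟨by simp, Bigraph.graph7_spec⟩
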